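/- Let $d\ge 1$. For $x_0\in\mathbb{R}^d$ and $l,\sigma>0$ write $S^l_\sigma(x_0):=x_0+(-l,l)\times\left(-\tfrac{\sigma}{2},\tfrac{\sigma}{2}\right)^{d-1}$. For a Lebesgue measurable set $P\subset\mathbb{R}^d$ let $\partial^*P$ be its essential boundary, i.e. the set of points of $\mathbb{R}^d$ at which $P$ has neither $d$-dimensional Lebesgue density $0$ nor density $1$. Let $\mathcal{L}^d$ be Lebesgue measure and $\mathcal{H}^{d-1}$ the $(d-1)$-dimensional Hausdorff measure, normalized to agree with Lebesgue measure on $\mathbb{R}^{d-1}$. A measurable set $P$ has finite perimeter in an open set $U$ if $\sup\left\{\int_P\operatorname{div}\varphi\,dx:\ \varphi\in C^1_c(U;\mathbb{R}^d),\ |\varphi|\le 1\right\}<\infty$. Then there exists a constant $C_{\rm iso}\ge 1$ depending only on $d$ such that for all $l,\sigma>0$ with $l/\sigma\ge 1$, all $x_0\in\mathbb{R}^d$, and every measurable set $P\subset S^l_\sigma(x_0)$ of finite perimeter in $S^l_\sigma(x_0)$ with $$\mathcal{H}^{d-1}\left(\partial^*P\cap S^l_\sigma(x_0)\right)<\sigma^{d-1},$$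 it holds that $$\min\left\{\mathcal{L}^d(P),\ \mathcal{L}^d\left(S^l_\sigma(x_0)\setminus P\right)\right\}\le C_{\rm iso}\,\sigma\,\mathcal{H}^{d-1}\left(\partial^*P\cap S^l_\sigma(x_0)\right).$$ -/

import Mathlib

open MeasureTheory Set Filter
open scoped ENNReal Topology

noncomputable section

namespace LongCuboid

/-- The open cuboid `x₀ + (-l, l) × (-σ/2, σ/2)^(d-1)` in `ℝ^d`; the long direction is the
first coordinate. -/
def cuboid {d : ℕ} (x₀ : EuclideanSpace ℝ (Fin d)) (l σ : ℝ) : Set (EuclideanSpace ℝ (Fin d)) :=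
  {x | ∀ i : Fin d, x i - x₀ i ∈
    if (i : ℕ) = 0 then Ioo (-l) l else Ioo (-(σ / 2)) (σ / 2)}

/-- The divergence of a vector field on `ℝ^d`. -/
def divergence {d : ℕ} (φ : EuclideanSpace ℝ (Fin d) → EuclideanSpace ℝ (Fin d))
    (x : EuclideanSpace ℝ (Fin d)) : ℝ :=
  ∑ i : Fin d, (fderiv ℝ φ x (EuclideanSpace.single i 1)) i

/-- `φ ∈ C_c^1(U; ℝ^d)` with `|φ| ≤ 1` everywhere (Euclidean norm). -/
structure IsTestField {d : ℕ} (U : Set (EuclideanSpace ℝ (Fin d)))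
    (φ : EuclideanSpace ℝ (Fin d) → EuclideanSpace ℝ (Fin d)) : Prop where
  contDiff : ContDiff ℝ 1 φ
  hasCompactSupport : HasCompactSupport φ
  tsupport_subset : tsupport φ ⊆ U
  norm_le_one : ∀ x, ‖φ x‖ ≤ 1

/-- `E` is a (Lebesgue measurable) set of finite perimeter in the open set `U`: the variation
`sup {∫_E div φ : φ ∈ C_c^1(U; ℝ^d), |φ| ≤ 1}` of its indicator function in `U` is finite. -/
structure HasFinitePerimeterIn {d : ℕ} (E U : Set (EuclideanSpace ℝ (Fin d))) : Prop where
  nullMeasurableSet : NullMeasurableSet E volume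
  bddAbove : ∃ M : ℝ, ∀ φ, IsTestField U φ → ∫ x in E, divergence φ x ≤ M

/-- The set `E^s` of points at which `E` has (`d`-dimensional Lebesgue) density `s`. -/
def densityPoints {d : ℕ} (E : Set (EuclideanSpace ℝ (Fin d))) (s : ℝ≥0∞) :
    Set (EuclideanSpace ℝ (Fin d)) :=
  {x | Tendsto (fun r : ℝ => volume (E ∩ Metric.ball x r) / volume (Metric.ball x r))
    (𝓝[>] 0) (𝓝 s)}

/-- The essential boundary `∂*E = ℝ^d \ (E^0 ∪ E^1)`. -/
def essentialBoundary {d : ℕ} (E : Set (EuclideanSpace ℝ (Fin d))) :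
    Set (EuclideanSpace ℝ (Fin d)) :=
  (densityPoints E 0 ∪ densityPoints E 1)ᶜ

/-- `H^{d-1}(∂*E ∩ U)`, with the `(d-1)`-dimensional Hausdorff measure normalized so as to
agree with Lebesgue measure on `(d-1)`-dimensional Euclidean space. -/
def relativePerimeter {d : ℕ} (E U : Set (EuclideanSpace ℝ (Fin d))) : ℝ≥0∞ :=
  Measure.euclideanHausdorffMeasure (d - 1) (essentialBoundary E ∩ U)

end LongCuboid

end

namespace LongCuboid

open Metric

/-- The points around which `A` occupies only a small fixed fraction of every ball of radius less
than `ρ`. -/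
def thinPoints {n : ℕ} (A : Set (ℝ × (Fin n → ℝ))) (ρ : ℝ) : Set (ℝ × (Fin n → ℝ)) :=
  {x | ∀ r, 0 < r → r < ρ → volume (A ∩ ball x r) ≤ ENNReal.ofReal (r ^ (n + 1) / 2 ^ (n + 4))}

lemma thinPoints_anti {n : ℕ} (A : Set (ℝ × (Fin n → ℝ))) {ρ ρ' : ℝ} (h : ρ ≤ ρ') :
    thinPoints A ρ' ⊆ thinPoints A ρ :=
  fun _ hx r h0 hr => hx r h0 (hr.trans_le h)

lemma isOpen_lt_volume_inter_ball {n : ℕ} (A : Set (ℝ × (Fin n → ℝ))) (r : ℝ) (c : ℝ≥0∞) :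
    IsOpen {x | c < volume (A ∩ ball x r)} := by
  rw [Metric.isOpen_iff]
  intro x hx
  have hU : ball x r = ⋃ k : ℕ, ball x (r - 1 / ((k : ℝ) + 1)) := by
    ext y
    simp only [mem_ball, mem_iUnion]
    constructor
    · intro h
      obtain ⟨k, hk⟩ := exists_nat_one_div_lt (sub_pos.2 h)
      exact ⟨k, by linarith⟩
    · rintro ⟨k, hk⟩
      have : (0 : ℝ) < 1 / ((k : ℝ) + 1) := by positivity
      linarith
  have hmono : Monotone fun k : ℕ => A ∩ ball x (r - 1 / ((k : ℝ) + 1)) := by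
    intro k k' hk
    refine inter_subset_inter_right _ (ball_subset_ball ?_)
    have : 1 / ((k' : ℝ) + 1) ≤ 1 / ((k : ℝ) + 1) := by
      apply one_div_le_one_div_of_le (by positivity)
      exact_mod_cast Nat.succ_le_succ hk
    linarith
  simp only [mem_ofPred_eq] at hx
  rw [hU, inter_iUnion, hmono.measure_iUnion, lt_iSup_iff] at hx
  obtain ⟨k, hk⟩ := hx
  refine ⟨1 / ((k : ℝ) + 1), by positivity, fun y hy => hk.trans_le (measure_mono ?_)⟩
  refine inter_subset_inter_right _ (ball_subset_ball' ?_)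
  rw [mem_ball, dist_comm] at hy
  linarith

lemma isClosed_thinPoints {n : ℕ} (A : Set (ℝ × (Fin n → ℝ))) (ρ : ℝ) :
    IsClosed (thinPoints A ρ) := by
  have : thinPoints A ρ = ⋂ (r : ℝ) (_ : 0 < r) (_ : r < ρ),
      {x | volume (A ∩ ball x r) ≤ ENNReal.ofReal (r ^ (n + 1) / 2 ^ (n + 4))} := by
    ext x; simp [thinPoints]
  rw [this]
  refine isClosed_iInter fun r => isClosed_iInter fun _ => isClosed_iInter fun _ => ?_
  have h := (isOpen_lt_volume_inter_ball A r (ENNReal.ofReal (r ^ (n + 1) / 2 ^ (n + 4)))).isClosed_compl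
  convert h using 1
  ext x; simp

/-- A set of positive outer measure fills at least half of some arbitrarily small cubes. -/
lemma exists_half_le_volume_inter_closedBall {n : ℕ} {s : Set (Fin n → ℝ)} (hs : volume s ≠ 0)
    {ε : ℝ} (hε : 0 < ε) : ∃ z ∈ s, ∃ r, 0 < r ∧ r < ε ∧
      ENNReal.ofReal ((2 * r) ^ n / 2) ≤ volume (s ∩ closedBall z r) := by
  have h := Besicovitch.ae_tendsto_measure_inter_div volume s
  have hne : ∃ z ∈ s, Tendsto (fun r => volume (s ∩ closedBall z r) / volume (closedBall z r))
      (𝓝[>] 0) (𝓝 1) := by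
    by_contra! hcon
    apply hs
    refine le_antisymm ?_ zero_le
    calc volume s ≤ volume ({z | ¬ Tendsto (fun r => volume (s ∩ closedBall z r) /
          volume (closedBall z r)) (𝓝[>] 0) (𝓝 1)} ∩ s) :=
          measure_mono fun z hz => ⟨hcon z hz, hz⟩
      _ ≤ (volume.restrict s) _ := Measure.le_restrict_apply _ _
      _ = 0 := h
  obtain ⟨z, hz, ht⟩ := hne
  have h1 : ∀ᶠ r in 𝓝[>] (0 : ℝ), (1 / 2 : ℝ≥0∞) < volume (s ∩ closedBall z r) /
      volume (closedBall z r) :=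
    ht.eventually (lt_mem_nhds (by simp))
  have h2 : ∀ᶠ r in 𝓝[>] (0 : ℝ), r ∈ Ioo 0 ε := Ioo_mem_nhdsGT hε
  obtain ⟨r, hr, hr0, hrε⟩ := (h1.and h2).exists
  refine ⟨z, hz, r, hr0, hrε, ?_⟩
  have hv : volume (closedBall z r) = ENNReal.ofReal ((2 * r) ^ n) := by
    rw [Real.volume_pi_closedBall _ hr0.le]; simp
  rw [hv] at hr
  have hp : 0 < (2 * r) ^ n := by positivity
  have := (ENNReal.le_div_iff_mul_le (Or.inl (by simpa using hp)) (Or.inl (by simp))).1 hr.le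
  refine le_trans (le_of_eq ?_) this
  rw [div_eq_inv_mul, ENNReal.ofReal_mul (by norm_num), one_div, ENNReal.ofReal_inv_of_pos (by norm_num)]
  simp

/-- The projections of the thin points of `A` from which one can move a fixed distance in one
direction inside a set `J` that is almost contained in `A` form a null set. -/
lemma volume_snd_image_thinPoints {n : ℕ} {A J : Set (ℝ × (Fin n → ℝ))} (hJ : volume (J \ A) = 0)
    {ρ : ℝ} (hρ : 0 < ρ) {ε : ℝ} (hε : ε = 1 ∨ ε = -1) :
    volume (Prod.snd '' {x | x ∈ thinPoints A ρ ∧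
      ∀ s ∈ Ioo 0 ρ, (x.1 + ε * s, x.2) ∈ J}) = 0 := by
  have hεε : ε * ε = 1 := by rcases hε with rfl | rfl <;> norm_num
  have hεabs : |ε| = 1 := by rcases hε with rfl | rfl <;> norm_num
  set M := {x | x ∈ thinPoints A ρ ∧ ∀ s ∈ Ioo 0 ρ, (x.1 + ε * s, x.2) ∈ J} with hM
  have hcov : Prod.snd '' M ⊆ ⋃ j : ℤ, Prod.snd '' (M ∩ {x | ⌊ε * x.1 / (ρ / 4)⌋ = j}) := by
    rintro _ ⟨x, hx, rfl⟩
    exact mem_iUnion.2 ⟨_, x, ⟨hx, rfl⟩, rfl⟩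
  refine measure_mono_null hcov (measure_iUnion_null fun j => ?_)
  set Mj := M ∩ {x | ⌊ε * x.1 / (ρ / 4)⌋ = j} with hMj
  have hclose : ∀ x ∈ Mj, ∀ y ∈ Mj, ε * x.1 - ε * y.1 < ρ / 4 := by
    rintro x ⟨-, hx⟩ y ⟨-, hy⟩
    simp only [mem_ofPred_eq] at hx hy
    have h := Int.abs_sub_lt_one_of_floor_eq_floor (hx.trans hy.symm)
    rw [← sub_div, abs_lt] at h
    have := (div_lt_one (by positivity : 0 < ρ / 4)).1 h.2
    exact this
  by_contra hpos
  obtain ⟨z, hz, r, hr0, hr, hhalf⟩ := exists_half_le_volume_inter_closedBall hpos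
    (show 0 < ρ / 8 by positivity)
  set T := (fun x : ℝ × (Fin n → ℝ) => ε * x.1) '' (Mj ∩ {x | x.2 ∈ closedBall z r}) with hT
  have hTne : T.Nonempty := by
    obtain ⟨x, hx, rfl⟩ := hz
    exact ⟨_, x, ⟨hx, mem_closedBall_self hr0.le⟩, rfl⟩
  obtain ⟨_, x₁, ⟨hx₁, -⟩, rfl⟩ := id hTne
  have hTb : BddAbove T := by
    refine ⟨ε * x₁.1 + ρ / 4, ?_⟩
    rintro _ ⟨y, ⟨hy, -⟩, rfl⟩
    have := hclose y hy x₁ hx₁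
    simp only
    linarith
  set τ := sSup T with hτ
  obtain ⟨_, ⟨x, ⟨hx, hxz⟩, rfl⟩, hxτ⟩ := exists_lt_of_lt_csSup hTne
    (show τ - r < sSup T by linarith)
  simp only at hxτ
  have hxle : ε * x.1 ≤ τ := le_csSup hTb ⟨x, ⟨hx, hxz⟩, rfl⟩
  have hW : ((fun t => ε * t) ⁻¹' Ioo τ (τ + r)) ×ˢ (Prod.snd '' Mj ∩ closedBall z r) ⊆
      J ∩ ball x (4 * r) := by
    rintro ⟨t, _⟩ ⟨⟨ht1, ht2⟩, ⟨y, hy, rfl⟩, hyz⟩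
    simp only at ht1 ht2 hyz
    have hyle : ε * y.1 ≤ τ := le_csSup hTb ⟨y, ⟨hy, hyz⟩, rfl⟩
    have hyx := hclose x hx y hy
    constructor
    · have := hy.1.2 (ε * t - ε * y.1) ⟨by linarith, by linarith⟩
      have e : y.1 + ε * (ε * t - ε * y.1) = t := by
        rw [mul_sub, ← mul_assoc, ← mul_assoc, hεε]; ring
      rwa [e] at this
    · rw [mem_ball, Prod.dist_eq, max_lt_iff]
      constructor
      · have : |t - x.1| = |ε * t - ε * x.1| := by
          rw [← mul_sub, abs_mul, hεabs, one_mul]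
        rw [Real.dist_eq, this, abs_lt]
        constructor <;> linarith
      · have h1 : dist y.2 z ≤ r := hyz
        have h2 : dist x.2 z ≤ r := hxz
        have := dist_triangle_right y.2 x.2 z
        simp only
        linarith
  have hvol : volume ((fun t => ε * t) ⁻¹' Ioo τ (τ + r)) = ENNReal.ofReal r := by
    rw [Real.volume_preimage_mul_left (by rintro rfl; norm_num at hεabs), abs_inv, hεabs]
    simp
  have h1 : ENNReal.ofReal r * ENNReal.ofReal ((2 * r) ^ n / 2) ≤ volume (J ∩ ball x (4 * r)) := by
    refine le_trans ?_ (measure_mono hW)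
    rw [Measure.volume_eq_prod, Measure.prod_prod, hvol]
    gcongr
  have h2 : volume (J ∩ ball x (4 * r)) ≤ volume (A ∩ ball x (4 * r)) := by
    calc volume (J ∩ ball x (4 * r)) ≤ volume ((A ∩ ball x (4 * r)) ∪ (J \ A)) := by
          refine measure_mono fun y hy => ?_
          by_cases hyA : y ∈ A
          · exact Or.inl ⟨hyA, hy.2⟩
          · exact Or.inr ⟨hy.1, hyA⟩
      _ ≤ _ := measure_union_le _ _
      _ = _ := by rw [hJ, add_zero]
  have h3 := (h1.trans h2).trans (hx.1.1 (4 * r) (by positivity) (by linarith))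
  rw [← ENNReal.ofReal_mul hr0.le, ENNReal.ofReal_le_ofReal_iff (by positivity)] at h3
  have h4 : r * ((2 * r) ^ n / 2) = 2 * ((4 * r) ^ (n + 1) / 2 ^ (n + 4)) := by
    have : (4 : ℝ) ^ n = 2 ^ n * 2 ^ n := by rw [← mul_pow]; norm_num
    rw [mul_pow, mul_pow, pow_succ, pow_succ, pow_add, this]
    field_simp
    norm_num
  have h5 : 0 < (4 * r) ^ (n + 1) / 2 ^ (n + 4) := by positivity
  linarith

end LongCuboid

namespace LongCuboid

open Metric

lemma exists_gap_right {P Q : Set ℝ} {u v x₀ q : ℝ} (hcov : Icc u v ⊆ P ∪ Q)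
    (hx₀ : x₀ ∈ closure (P ∩ Icc u v)) (hq : q ∈ Q ∩ Icc u v) (hlt : x₀ < q)
    (hqP : q ∉ closure (P ∩ Icc u v)) :
    ∃ x ∈ Ico x₀ q, x ∈ closure (P ∩ Icc u v) ∩ closure (Q ∩ Icc u v) ∧ Ioc x q ⊆ Q := by
  set S := closure (P ∩ Icc u v) ∩ Icc x₀ q with hS
  have hSc : IsClosed S := isClosed_closure.inter isClosed_Icc
  have hSne : S.Nonempty := ⟨x₀, hx₀, le_rfl, hlt.le⟩
  have hSb : BddAbove S := ⟨q, fun y hy => hy.2.2⟩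
  have hmem : sSup S ∈ S := hSc.csSup_mem hSne hSb
  have hu : u ≤ x₀ := by
    have : closure (P ∩ Icc u v) ⊆ Icc u v :=
      closure_minimal inter_subset_right isClosed_Icc
    exact (this hx₀).1
  have hneq : sSup S < q := lt_of_le_of_ne hmem.2.2 fun h => hqP (h ▸ hmem.1)
  have hQ : Ioc (sSup S) q ⊆ Q ∩ Icc u v := by
    intro y hy
    have hyI : y ∈ Icc u v := ⟨hu.trans (hmem.2.1.trans hy.1.le), hy.2.trans hq.2.2⟩
    refine ⟨(hcov hyI).resolve_left fun hyP => ?_, hyI⟩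
    exact absurd (le_csSup hSb ⟨subset_closure ⟨hyP, hyI⟩, hmem.2.1.trans hy.1.le, hy.2⟩)
      (not_le.2 hy.1)
  refine ⟨sSup S, ⟨hmem.2.1, hneq⟩, ⟨hmem.1, ?_⟩, hQ.trans inter_subset_left⟩
  have : sSup S ∈ closure (Ioc (sSup S) q) := by
    rw [closure_Ioc hneq.ne]; exact left_mem_Icc.2 hneq.le
  exact closure_mono hQ this

lemma exists_gap_left {P Q : Set ℝ} {u v x₀ q : ℝ} (hcov : Icc u v ⊆ P ∪ Q)
    (hx₀ : x₀ ∈ closure (P ∩ Icc u v)) (hq : q ∈ Q ∩ Icc u v) (hlt : q < x₀)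
    (hqP : q ∉ closure (P ∩ Icc u v)) :
    ∃ x ∈ Ioc q x₀, x ∈ closure (P ∩ Icc u v) ∩ closure (Q ∩ Icc u v) ∧ Ico q x ⊆ Q := by
  set S := closure (P ∩ Icc u v) ∩ Icc q x₀ with hS
  have hSc : IsClosed S := isClosed_closure.inter isClosed_Icc
  have hSne : S.Nonempty := ⟨x₀, hx₀, hlt.le, le_rfl⟩
  have hSb : BddBelow S := ⟨q, fun y hy => hy.2.1⟩
  have hmem : sInf S ∈ S := hSc.csInf_mem hSne hSb
  have hv : x₀ ≤ v := by
    have : closure (P ∩ Icc u v) ⊆ Icc u v :=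
      closure_minimal inter_subset_right isClosed_Icc
    exact (this hx₀).2
  have hneq : q < sInf S := lt_of_le_of_ne hmem.2.1 fun h => hqP (h ▸ hmem.1)
  have hQ : Ico q (sInf S) ⊆ Q ∩ Icc u v := by
    intro y hy
    have hyI : y ∈ Icc u v := ⟨hq.2.1.trans hy.1, (hy.2.le.trans hmem.2.2).trans hv⟩
    refine ⟨(hcov hyI).resolve_left fun hyP => ?_, hyI⟩
    exact absurd (csInf_le hSb ⟨subset_closure ⟨hyP, hyI⟩, hy.1, hy.2.le.trans hmem.2.2⟩)
      (not_le.2 hy.2)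
  refine ⟨sInf S, ⟨hneq, hmem.2.2⟩, ⟨hmem.1, ?_⟩, hQ.trans inter_subset_left⟩
  have : sInf S ∈ closure (Ico q (sInf S)) := by
    rw [closure_Ico hneq.ne]; exact right_mem_Icc.2 hneq.le
  exact closure_mono hQ this

/-- If near `x₀` the common boundary of `P` and `Q` is contained in a set `F` disjoint from `Q`,
then some point of `F` is an endpoint of an interval in `Q`. -/
lemma exists_one_sided_of_boundary_subset {P Q F : Set ℝ} {u v x₀ δ : ℝ}
    (hcov : Icc u v ⊆ P ∪ Q) (hFQ : Disjoint F Q) (hδ : 0 < δ)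
    (hx₀P : x₀ ∈ closure (P ∩ Icc u v)) (hx₀Q : x₀ ∈ closure (Q ∩ Icc u v))
    (hF : ∀ x ∈ closure (P ∩ Icc u v) ∩ closure (Q ∩ Icc u v), dist x x₀ < δ → x ∈ F) :
    ∃ ε : ℝ, (ε = 1 ∨ ε = -1) ∧ ∃ ρ > 0, ∃ x ∈ F, ∀ s ∈ Ioo 0 ρ, x + ε * s ∈ Q := by
  have hx₀F : x₀ ∈ F := hF x₀ ⟨hx₀P, hx₀Q⟩ (by simpa using hδ)
  obtain ⟨q, hq, hqd⟩ := Metric.mem_closure_iff.1 hx₀Q δ hδ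
  have hne : q ≠ x₀ := fun h => disjoint_left.1 hFQ hx₀F (h ▸ hq.1)
  have hqP : q ∉ closure (P ∩ Icc u v) := fun h =>
    disjoint_left.1 hFQ (hF q ⟨h, subset_closure hq⟩ (by rwa [dist_comm])) hq.1
  rw [Real.dist_eq, abs_lt] at hqd
  rcases lt_or_gt_of_ne hne with h | h
  · obtain ⟨x, hx, hxb, hxQ⟩ := exists_gap_left hcov hx₀P hq h hqP
    refine ⟨-1, Or.inr rfl, x - q, sub_pos.2 hx.1, x, hF x hxb ?_, fun s hs => hxQ ?_⟩
    · rw [Real.dist_eq, abs_lt]; constructor <;> linarith [hx.1, hx.2]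
    · constructor <;> linarith [hs.1, hs.2]
  · obtain ⟨x, hx, hxb, hxQ⟩ := exists_gap_right hcov hx₀P hq h hqP
    refine ⟨1, Or.inl rfl, q - x, sub_pos.2 hx.2, x, hF x hxb ?_, fun s hs => hxQ ?_⟩
    · rw [Real.dist_eq, abs_lt]; constructor <;> linarith [hx.1, hx.2]
    · constructor <;> linarith [hs.1, hs.2]

/-- If an interval is divided into two nonempty sets `P` and `Q`, each covered by countably many
closed sets avoiding the other one, then one of these closed sets contains an endpoint of an
interval lying in the other part. -/
lemma exists_one_sided_of_cover {P Q : Set ℝ} {u v : ℝ} (hcov : Icc u v ⊆ P ∪ Q)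
    {F G : ℕ → Set ℝ} (hFc : ∀ k, IsClosed (F k)) (hGc : ∀ k, IsClosed (G k))
    (hPF : P ∩ Icc u v ⊆ ⋃ k, F k) (hQG : Q ∩ Icc u v ⊆ ⋃ k, G k)
    (hFQ : ∀ k, Disjoint (F k) Q) (hGP : ∀ k, Disjoint (G k) P)
    (hP : (P ∩ Icc u v).Nonempty) (hQ : (Q ∩ Icc u v).Nonempty) :
    ∃ ε : ℝ, (ε = 1 ∨ ε = -1) ∧ ∃ ρ > 0, ∃ k, ∃ x,
      (x ∈ F k ∧ ∀ s ∈ Ioo 0 ρ, x + ε * s ∈ Q) ∨ (x ∈ G k ∧ ∀ s ∈ Ioo 0 ρ, x + ε * s ∈ P) := by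
  set D := closure (P ∩ Icc u v) ∩ closure (Q ∩ Icc u v) with hD
  have hDI : D ⊆ Icc u v := inter_subset_left.trans
    (closure_minimal inter_subset_right isClosed_Icc)
  have hDc : IsClosed D := isClosed_closure.inter isClosed_closure
  have hDne : D.Nonempty := by
    have h := isPreconnected_closed_iff.1 (isPreconnected_Icc (a := u) (b := v))
      (closure (P ∩ Icc u v)) (closure (Q ∩ Icc u v)) isClosed_closure isClosed_closure
      (fun x hx => (hcov hx).imp (fun h => subset_closure ⟨h, hx⟩)
        fun h => subset_closure ⟨h, hx⟩)
      (hP.mono fun x hx => ⟨hx.2, subset_closure hx⟩)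
      (hQ.mono fun x hx => ⟨hx.2, subset_closure hx⟩)
    exact h.mono inter_subset_right
  have : CompactSpace D := isCompact_iff_compactSpace.1 (isCompact_Icc.of_isClosed_subset hDc hDI)
  have : Nonempty D := hDne.to_subtype
  let C : ℕ ⊕ ℕ → Set D := Sum.elim (fun k => (↑) ⁻¹' F k) (fun k => (↑) ⁻¹' G k)
  have hC : ∀ i, IsClosed (C i) := by
    rintro (k | k)
    · exact (hFc k).preimage continuous_subtype_val
    · exact (hGc k).preimage continuous_subtype_val
  have hU : ⋃ i, C i = univ := by
    refine eq_univ_of_forall fun x => ?_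
    have hxI := hDI x.2
    rcases hcov hxI with h | h
    · obtain ⟨k, hk⟩ := mem_iUnion.1 (hPF ⟨h, hxI⟩)
      exact mem_iUnion.2 ⟨Sum.inl k, hk⟩
    · obtain ⟨k, hk⟩ := mem_iUnion.1 (hQG ⟨h, hxI⟩)
      exact mem_iUnion.2 ⟨Sum.inr k, hk⟩
  obtain ⟨i, x₀, hx₀⟩ := nonempty_interior_of_iUnion_of_closed hC hU
  obtain ⟨δ, hδ, hball⟩ := Metric.mem_nhds_iff.1 (mem_interior_iff_mem_nhds.1 hx₀)
  rcases i with k | k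
  · obtain ⟨ε, hε, ρ, hρ, x, hx, h⟩ := exists_one_sided_of_boundary_subset hcov (hFQ k) hδ
      x₀.2.1 x₀.2.2 (fun x hx hd => hball (show (⟨x, hx⟩ : D) ∈ ball x₀ δ from hd))
    exact ⟨ε, hε, ρ, hρ, k, x, Or.inl ⟨hx, h⟩⟩
  · obtain ⟨ε, hε, ρ, hρ, x, hx, h⟩ := exists_one_sided_of_boundary_subset
      (hcov.trans (union_comm P Q).subset) (hGP k) hδ x₀.2.2 x₀.2.1
      (fun x hx hd => hball (show (⟨x, hx.symm⟩ : D) ∈ ball x₀ δ from hd))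
    exact ⟨ε, hε, ρ, hρ, k, x, Or.inr ⟨hx, h⟩⟩

end LongCuboid

namespace LongCuboid

open Metric

/-- The points at which `A` has density zero with respect to cubes. -/
def sparsePoints {n : ℕ} (A : Set (ℝ × (Fin n → ℝ))) : Set (ℝ × (Fin n → ℝ)) :=
  {x | Tendsto (fun r : ℝ => volume (A ∩ ball x r) / ENNReal.ofReal (r ^ (n + 1)))
    (𝓝[>] 0) (𝓝 0)}

lemma volume_prod_closedBall {n : ℕ} (x : ℝ × (Fin n → ℝ)) {r : ℝ} (hr : 0 < r) :
    volume (closedBall x r) = ENNReal.ofReal ((2 * r) ^ (n + 1)) := by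
  rw [← closedBall_prod_same, Measure.volume_eq_prod, Measure.prod_prod, Real.volume_closedBall,
    Real.volume_pi_closedBall _ hr.le, ← ENNReal.ofReal_mul (by positivity)]
  simp [pow_succ']

lemma volume_prod_ball {n : ℕ} (x : ℝ × (Fin n → ℝ)) {r : ℝ} (hr : 0 < r) :
    volume (ball x r) = ENNReal.ofReal ((2 * r) ^ (n + 1)) := by
  rw [← ball_prod_same, Measure.volume_eq_prod, Measure.prod_prod, Real.volume_ball,
    Real.volume_pi_ball _ hr, ← ENNReal.ofReal_mul (by positivity)]
  simp [pow_succ']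

lemma eventually_volume_le_of_mem_sparsePoints {n : ℕ} {A : Set (ℝ × (Fin n → ℝ))}
    {x : ℝ × (Fin n → ℝ)} (hx : x ∈ sparsePoints A) {c : ℝ} (hc : 0 < c) :
    ∀ᶠ r in 𝓝[>] (0 : ℝ), volume (A ∩ ball x r) ≤ ENNReal.ofReal (r ^ (n + 1) * c) := by
  have h1 := Tendsto.eventually hx (gt_mem_nhds (show (0 : ℝ≥0∞) < ENNReal.ofReal c by simpa using hc))
  filter_upwards [h1, self_mem_nhdsWithin] with r hr hr0
  have hp : 0 < r ^ (n + 1) := pow_pos hr0 _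
  rw [ENNReal.div_lt_iff (Or.inl (by simpa using hp)) (Or.inl (by simp)),
    ← ENNReal.ofReal_mul hc.le, mul_comm c] at hr
  exact hr.le

lemma sparsePoints_subset_iUnion_thinPoints {n : ℕ} (A : Set (ℝ × (Fin n → ℝ))) :
    sparsePoints A ⊆ ⋃ k : ℕ, thinPoints A (1 / ((k : ℝ) + 1)) := by
  intro x hx
  have h := eventually_volume_le_of_mem_sparsePoints hx
    (show (0 : ℝ) < 1 / 2 ^ (n + 4) by positivity)
  obtain ⟨ρ, hρ, hsub⟩ := mem_nhdsGT_iff_exists_Ioo_subset.1 h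
  obtain ⟨k, hk⟩ := exists_nat_one_div_lt (show (0 : ℝ) < ρ from hρ)
  refine mem_iUnion.2 ⟨k, fun r h0 hr => ?_⟩
  have := hsub ⟨h0, hr.trans hk⟩
  rwa [mem_ofPred_eq, mul_one_div] at this

lemma disjoint_thinPoints_sparsePoints_compl {n : ℕ} (A : Set (ℝ × (Fin n → ℝ))) {ρ : ℝ}
    (hρ : 0 < ρ) : Disjoint (thinPoints A ρ) (sparsePoints Aᶜ) := by
  rw [disjoint_left]
  intro x hx hx'
  have h := eventually_volume_le_of_mem_sparsePoints hx' (show (0 : ℝ) < 1 / 2 by norm_num)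
  obtain ⟨r, hr, hr0, hrρ⟩ := (h.and (Ioo_mem_nhdsGT hρ)).exists
  have h1 := hx r hr0 hrρ
  have h2 : volume (ball x r) ≤ volume (A ∩ ball x r) + volume (Aᶜ ∩ ball x r) := by
    refine le_trans (measure_mono fun y hy => ?_) (measure_union_le _ _)
    by_cases hyA : y ∈ A
    · exact Or.inl ⟨hyA, hy⟩
    · exact Or.inr ⟨hyA, hy⟩
  have hp : 0 < r ^ (n + 1) := pow_pos hr0 _
  have h3 := h2.trans (add_le_add h1 hr)
  rw [volume_prod_ball x hr0, ← ENNReal.ofReal_add (by positivity) (by positivity),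
    ENNReal.ofReal_le_ofReal_iff (by positivity), mul_pow] at h3
  have h4 : (1 : ℝ) ≤ 2 ^ (n + 1) := one_le_pow₀ (by norm_num)
  have h5 : r ^ (n + 1) / 2 ^ (n + 4) ≤ r ^ (n + 1) / 4 := by
    apply div_le_div_of_nonneg_left hp.le (by norm_num)
    calc (4 : ℝ) = 2 ^ 2 := by norm_num
      _ ≤ 2 ^ (n + 4) := pow_le_pow_right₀ (by norm_num) (by omega)
  nlinarith

lemma disjoint_sparsePoints {n : ℕ} (A : Set (ℝ × (Fin n → ℝ))) :
    Disjoint (sparsePoints A) (sparsePoints Aᶜ) := by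
  rw [disjoint_left]
  intro x hx hx'
  obtain ⟨k, hk⟩ := mem_iUnion.1 (sparsePoints_subset_iUnion_thinPoints A hx)
  exact disjoint_left.1 (disjoint_thinPoints_sparsePoints_compl A (by positivity)) hk hx'

lemma ae_mem_sparsePoints_of_notMem {n : ℕ} {A : Set (ℝ × (Fin n → ℝ))} (hA : MeasurableSet A) :
    ∀ᵐ x, x ∉ A → x ∈ sparsePoints A := by
  filter_upwards [Besicovitch.ae_tendsto_measure_inter_div_of_measurableSet volume hA] with x hx hxA
  rw [indicator_of_notMem hxA] at hx
  have h2 : Tendsto (fun r => ENNReal.ofReal (2 ^ (n + 1)) *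
      (volume (A ∩ closedBall x r) / volume (closedBall x r))) (𝓝[>] 0) (𝓝 0) := by
    have := ENNReal.Tendsto.const_mul (a := ENNReal.ofReal (2 ^ (n + 1))) hx (Or.inr (by simp))
    simpa using this
  refine tendsto_of_tendsto_of_tendsto_of_le_of_le' tendsto_const_nhds h2
    (Eventually.of_forall fun _ => zero_le) ?_
  filter_upwards [self_mem_nhdsWithin] with r hr
  have hr : 0 < r := hr
  have hp : 0 < r ^ (n + 1) := pow_pos hr _
  rw [volume_prod_closedBall x hr, mul_pow, ENNReal.ofReal_mul (by positivity), ← mul_div_assoc,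
    ENNReal.mul_div_mul_left _ _ (by simp) (by simp)]
  gcongr
  exact ball_subset_closedBall

lemma volume_sparsePoints_compl_diff {n : ℕ} {A : Set (ℝ × (Fin n → ℝ))} (hA : MeasurableSet A) :
    volume (sparsePoints Aᶜ \ A) = 0 := by
  refine measure_mono_null (fun x hx => ?_) (ae_mem_sparsePoints_of_notMem hA)
  simp only [mem_compl_iff, mem_ofPred_eq, not_forall]
  exact ⟨hx.2, fun h => disjoint_left.1 (disjoint_sparsePoints A) h hx.1⟩

/-- On almost every line, an interval on which every point is a density point of `E` or of its
complement consists of points of one kind only. -/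
lemma ae_forall_sparsePoints_or {n : ℕ} {E : Set (ℝ × (Fin n → ℝ))} (hE : MeasurableSet E) :
    ∀ᵐ z : Fin n → ℝ, ∀ a b : ℝ,
      (∀ t ∈ Ioo a b, (t, z) ∈ sparsePoints E ∪ sparsePoints Eᶜ) →
      (∀ t ∈ Ioo a b, (t, z) ∈ sparsePoints E) ∨ (∀ t ∈ Ioo a b, (t, z) ∈ sparsePoints Eᶜ) := by
  have key : ∀ {A : Set (ℝ × (Fin n → ℝ))}, MeasurableSet A → ∀ᵐ z : Fin n → ℝ, ∀ m : ℕ,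
      ∀ ε : ℝ, (ε = 1 ∨ ε = -1) → ∀ x : ℝ, (x, z) ∈ thinPoints A (1 / ((m : ℝ) + 1)) →
      ¬ ∀ s ∈ Ioo (0 : ℝ) (1 / ((m : ℝ) + 1)), (x + ε * s, z) ∈ sparsePoints Aᶜ := by
    intro A hA
    rw [ae_all_iff]
    intro m
    have h : ∀ ε : ℝ, (ε = 1 ∨ ε = -1) → ∀ᵐ z : Fin n → ℝ,
        ∀ x : ℝ, (x, z) ∈ thinPoints A (1 / ((m : ℝ) + 1)) →
        ¬ ∀ s ∈ Ioo (0 : ℝ) (1 / ((m : ℝ) + 1)), (x + ε * s, z) ∈ sparsePoints Aᶜ := by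
      intro ε hε
      have h0 := volume_snd_image_thinPoints (volume_sparsePoints_compl_diff hA)
        (show (0 : ℝ) < 1 / ((m : ℝ) + 1) by positivity) hε
      refine measure_mono_null (fun z hz => ?_) h0
      by_contra hcon
      exact hz fun x hx hs => hcon ⟨(x, z), ⟨hx, hs⟩, rfl⟩
    filter_upwards [h 1 (Or.inl rfl), h (-1) (Or.inr rfl)] with z h1 h2 ε hε
    rcases hε with rfl | rfl
    · exact h1
    · exact h2
  filter_upwards [key hE, key hE.compl] with z h1 h2 a b hab
  by_contra! hcon
  obtain ⟨⟨p, hp, hpE⟩, ⟨q, hq, hqE⟩⟩ := hcon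
  have hcont : Continuous fun t : ℝ => (t, z) := by fun_prop
  have hsub : Icc (min p q) (max p q) ⊆ Ioo a b := fun t ht =>
    ⟨(lt_min hp.1 hq.1).trans_le ht.1, ht.2.trans_lt (max_lt hp.2 hq.2)⟩
  obtain ⟨ε, hε, ρ, hρ, k, x, hx⟩ := exists_one_sided_of_cover
    (P := {t | (t, z) ∈ sparsePoints E}) (Q := {t | (t, z) ∈ sparsePoints Eᶜ})
    (u := min p q) (v := max p q) (fun t ht => hab t (hsub ht))
    (F := fun k : ℕ => {t | (t, z) ∈ thinPoints E (1 / ((k : ℝ) + 1))})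
    (G := fun k : ℕ => {t | (t, z) ∈ thinPoints Eᶜ (1 / ((k : ℝ) + 1))})
    (fun k => (isClosed_thinPoints _ _).preimage hcont)
    (fun k => (isClosed_thinPoints _ _).preimage hcont)
    (fun t ht => by simpa using sparsePoints_subset_iUnion_thinPoints _ ht.1)
    (fun t ht => by simpa using sparsePoints_subset_iUnion_thinPoints _ ht.1)
    (fun k => disjoint_left.2 fun t ht => disjoint_left.1
      (disjoint_thinPoints_sparsePoints_compl E (by positivity)) ht)
    (fun k => disjoint_left.2 fun t ht ht' => disjoint_left.1
      (disjoint_thinPoints_sparsePoints_compl Eᶜ (ρ := 1 / ((k : ℝ) + 1)) (by positivity)) ht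
      (by rwa [compl_compl]))
    ⟨q, (hab q hq).resolve_right hqE, by simp, by simp⟩
    ⟨p, (hab p hp).resolve_left hpE, by simp, by simp⟩
  obtain ⟨m, hm⟩ := exists_nat_one_div_lt hρ
  have hle1 : 1 / (((max k m : ℕ) : ℝ) + 1) ≤ 1 / ((k : ℝ) + 1) := by
    apply one_div_le_one_div_of_le (by positivity)
    have : (k : ℝ) ≤ ((max k m : ℕ) : ℝ) := by exact_mod_cast le_max_left k m
    linarith
  have hle2 : 1 / (((max k m : ℕ) : ℝ) + 1) ≤ ρ := by
    refine le_trans ?_ hm.le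
    apply one_div_le_one_div_of_le (by positivity)
    have : (m : ℝ) ≤ ((max k m : ℕ) : ℝ) := by exact_mod_cast le_max_right k m
    linarith
  rcases hx with ⟨hx, hs⟩ | ⟨hx, hs⟩
  · exact h1 (max k m) ε hε x (thinPoints_anti _ hle1 hx) fun s h => hs s ⟨h.1, h.2.trans_le hle2⟩
  · refine h2 (max k m) ε hε x (thinPoints_anti _ hle1 hx) fun s h => ?_
    rw [compl_compl]
    exact hs s ⟨h.1, h.2.trans_le hle2⟩

/-- On almost every line, an interval free of essential boundary points of `E` is almost entirely
inside or almost entirely outside of `E`. -/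
theorem ae_slice_null_or_full {n : ℕ} {E : Set (ℝ × (Fin n → ℝ))} (hE : MeasurableSet E) :
    ∀ᵐ z : Fin n → ℝ, ∀ a b : ℝ,
      (∀ t ∈ Ioo a b, (t, z) ∈ sparsePoints E ∪ sparsePoints Eᶜ) →
      volume {t | t ∈ Ioo a b ∧ (t, z) ∈ E} = 0 ∨ volume {t | t ∈ Ioo a b ∧ (t, z) ∉ E} = 0 := by
  have h1 : ∀ᵐ x : ℝ × (Fin n → ℝ), (x ∈ sparsePoints E → x ∉ E) ∧ (x ∈ sparsePoints Eᶜ → x ∈ E) := by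
    filter_upwards [ae_mem_sparsePoints_of_notMem hE, ae_mem_sparsePoints_of_notMem hE.compl]
      with x h1 h2
    refine ⟨fun h hxE => ?_, fun h => ?_⟩
    · exact disjoint_left.1 (disjoint_sparsePoints E) h (h2 (not_not.2 hxE))
    · by_contra hxE
      exact disjoint_left.1 (disjoint_sparsePoints E) (h1 hxE) h
  have h2 : ∀ᵐ y : (Fin n → ℝ) × ℝ, (y.swap ∈ sparsePoints E → y.swap ∉ E) ∧
      (y.swap ∈ sparsePoints Eᶜ → y.swap ∈ E) :=
    (Measure.measurePreserving_swap (μ := (volume : Measure (Fin n → ℝ)))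
      (ν := (volume : Measure ℝ))).quasiMeasurePreserving.ae h1
  filter_upwards [ae_forall_sparsePoints_or hE, Measure.ae_ae_of_ae_prod h2] with z hz hz2 a b hab
  rcases hz a b hab with h | h
  · left
    refine measure_mono_null (fun t ht => ?_) hz2
    simp only [mem_compl_iff, mem_ofPred_eq, Prod.swap_prod_mk]
    exact fun h' => h'.1 (h t ht.1) ht.2
  · right
    refine measure_mono_null (fun t ht => ?_) hz2
    simp only [mem_compl_iff, mem_ofPred_eq, Prod.swap_prod_mk]
    exact fun h' => ht.2 (h'.2 (h t ht.1))

end LongCuboid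

namespace LongCuboid

open Function

section Cube

variable {ι : Type*} [DecidableEq ι]

/-- The fraction of the line through `y` in direction `i` that is occupied by `E`. -/
def lineFraction (μ : Measure ℝ) (E : Set (ι → ℝ)) (i : ι) (y : ι → ℝ) : ℝ≥0∞ :=
  μ {s | update y i s ∈ E}

/-- The points `y` such that neither `E` nor its complement is negligible on the line through `y`
in direction `i`. -/
def mixedLines (μ : Measure ℝ) (E : Set (ι → ℝ)) (i : ι) : Set (ι → ℝ) :=
  {y | lineFraction μ E i y ≠ 0 ∧ lineFraction μ Eᶜ i y ≠ 0}

lemma mixedLines_compl (μ : Measure ℝ) (E : Set (ι → ℝ)) (i : ι) :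
    mixedLines μ Eᶜ i = mixedLines μ E i := by
  ext y; simp [mixedLines, and_comm]

lemma lineFraction_update (μ : Measure ℝ) (E : Set (ι → ℝ)) (i : ι) (y : ι → ℝ) (s : ℝ) :
    lineFraction μ E i (update y i s) = lineFraction μ E i y := by
  simp [lineFraction]

lemma lineFraction_eq_lintegral (μ : Measure ℝ) {E : Set (ι → ℝ)} (hE : MeasurableSet E) (i : ι) (y : ι → ℝ) :
    lineFraction μ E i y = ∫⁻ s, E.indicator 1 (update y i s) ∂μ := by
  have hm : MeasurableSet {s | update y i s ∈ E} := measurable_update y hE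
  rw [lineFraction, ← lintegral_indicator_one hm]
  rfl

variable (μ : Measure ℝ) [IsProbabilityMeasure μ]

lemma lineFraction_add_compl {E : Set (ι → ℝ)} (hE : MeasurableSet E) (i : ι) (y : ι → ℝ) :
    lineFraction μ E i y + lineFraction μ Eᶜ i y = 1 := by
  have hm : MeasurableSet {s | update y i s ∈ E} := measurable_update y hE
  rw [lineFraction, lineFraction]
  exact prob_add_prob_compl hm

lemma measurable_lineFraction {E : Set (ι → ℝ)} (hE : MeasurableSet E) (i : ι) :
    Measurable (lineFraction μ E i) := by
  have h := lmarginal_singleton (μ := fun _ : ι => μ) (E.indicator 1) i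
  have : lineFraction μ E i = fun y => ∫⁻ s, E.indicator 1 (update y i s) ∂μ := by
    ext y; exact lineFraction_eq_lintegral μ hE i y
  rw [this, ← h]
  exact (measurable_one.indicator hE).lmarginal _

lemma measurableSet_mixedLines {E : Set (ι → ℝ)} (hE : MeasurableSet E) (i : ι) :
    MeasurableSet (mixedLines μ E i) :=
  ((measurable_lineFraction μ hE i) (measurableSet_singleton 0).compl).inter
    ((measurable_lineFraction μ hE.compl i) (measurableSet_singleton 0).compl)

variable [Fintype ι]

lemma lintegral_lintegral_update (i : ι) {F : (ι → ℝ) → ℝ≥0∞} (hF : Measurable F) :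
    ∫⁻ y, ∫⁻ s, F (update y i s) ∂μ ∂(Measure.pi fun _ : ι => μ) =
      ∫⁻ y, F y ∂(Measure.pi fun _ : ι => μ) := by
  have h := lmarginal_singleton (μ := fun _ : ι => μ) F i
  have hm : Measurable fun y => ∫⁻ s, F (update y i s) ∂μ := by
    rw [← h]; exact hF.lmarginal _
  refine lintegral_eq_of_lmarginal_eq {i} hm hF ?_
  rw [h, lmarginal_singleton]
  ext y
  simp

lemma lintegral_lineFraction {E : Set (ι → ℝ)} (hE : MeasurableSet E) (i : ι) :
    ∫⁻ y, lineFraction μ E i y ∂(Measure.pi fun _ : ι => μ) = (Measure.pi fun _ : ι => μ) E := by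
  simp_rw [lineFraction_eq_lintegral μ hE]
  rw [lintegral_lintegral_update μ i (measurable_one.indicator hE), lintegral_indicator_one hE]

lemma ae_lineFraction_ne_zero {E : Set (ι → ℝ)} (hE : MeasurableSet E) (i : ι) :
    ∀ᵐ y ∂(Measure.pi fun _ : ι => μ), y ∈ E → lineFraction μ E i y ≠ 0 := by
  set B : Set (ι → ℝ) := E ∩ {y | lineFraction μ E i y = 0} with hB
  have hBm : MeasurableSet B := hE.inter (measurable_lineFraction μ hE i (measurableSet_singleton 0))
  have h0 : (Measure.pi fun _ : ι => μ) B = 0 := by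
    rw [← lintegral_lineFraction μ hBm i, lintegral_eq_zero_iff (measurable_lineFraction μ hBm i)]
    refine Eventually.of_forall fun y => ?_
    by_cases hy : lineFraction μ E i y = 0
    · exact measure_mono_null (fun s hs => hs.1) hy
    · have : {s | update y i s ∈ B} = ∅ := by
        refine eq_empty_of_forall_notMem fun s hs => hy ?_
        have := hs.2
        rwa [mem_ofPred_eq, lineFraction_update] at this
      simp [lineFraction, this]
  refine measure_mono_null (fun y hy => ?_) h0
  simp only [mem_compl_iff, mem_ofPred_eq, Classical.not_imp, not_not] at hy
  exact hy

lemma ae_lineFraction_le {E : Set (ι → ℝ)} (hE : MeasurableSet E) (i : ι) :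
    ∀ᵐ y ∂(Measure.pi fun _ : ι => μ), lineFraction μ E i y ≤
      E.indicator 1 y + (mixedLines μ E i).indicator 1 y := by
  filter_upwards [ae_lineFraction_ne_zero μ hE.compl i] with y hy
  have h1 : lineFraction μ E i y ≤ 1 := prob_le_one
  by_cases hyE : y ∈ E
  · rw [indicator_of_mem hyE]
    exact h1.trans le_self_add
  · by_cases h0 : lineFraction μ E i y = 0
    · simp [h0]
    · have : y ∈ mixedLines μ E i := ⟨h0, hy hyE⟩
      rw [indicator_of_mem this]
      exact h1.trans le_add_self

/-- A Poincaré inequality on the cube: `E` and its complement are controlled by the lines in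
coordinate directions that meet both of them. -/
theorem measure_mul_measure_compl_le {E : Set (ι → ℝ)} (hE : MeasurableSet E) :
    (Measure.pi fun _ : ι => μ) E * (Measure.pi fun _ : ι => μ) Eᶜ ≤
      ∑ i, (Measure.pi fun _ : ι => μ) (mixedLines μ E i) := by
  set π := Measure.pi fun _ : ι => μ with hπ
  set g : (ι → ℝ) → ℝ≥0∞ := Eᶜ.indicator 1 with hg
  have hgm : Measurable g := measurable_one.indicator hE.compl
  have hL1 : ∀ s : Finset ι, ∀ x, (∫⋯∫⁻_s, g ∂fun _ => μ) x ≤ 1 := by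
    intro s x
    rw [lmarginal]
    refine (lintegral_mono (g := fun _ => 1) fun y => indicator_le_self' (s := Eᶜ) (by simp) _).trans ?_
    simp
  have key : ∀ s : Finset ι, ∫⁻ x, E.indicator 1 x * (∫⋯∫⁻_s, g ∂fun _ => μ) x ∂π ≤
      ∑ i ∈ s, π (mixedLines μ E i) := by
    intro s
    induction s using Finset.induction_on with
    | empty =>
      have : ∀ x, E.indicator (1 : (ι → ℝ) → ℝ≥0∞) x * g x = 0 := by
        intro x
        by_cases hx : x ∈ E <;> simp [hg, hx]
      simp [this]
    | insert k s hk ih =>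
      set L := ∫⋯∫⁻_s, g ∂fun _ => μ with hL
      have hLm : Measurable L := hgm.lmarginal _
      have hEm : Measurable (E.indicator (1 : (ι → ℝ) → ℝ≥0∞)) := measurable_one.indicator hE
      have hins : (∫⋯∫⁻_insert k s, g ∂fun _ => μ) = fun x => ∫⁻ u, L (update x k u) ∂μ := by
        ext x; exact lmarginal_insert g hgm hk x
      have hinsm : Measurable fun x => ∫⁻ u, L (update x k u) ∂μ := by
        rw [← hins]; exact hgm.lmarginal _
      have e1 : ∫⁻ x, E.indicator 1 x * (∫⋯∫⁻_insert k s, g ∂fun _ => μ) x ∂π =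
          ∫⁻ x, lineFraction μ E k x * ∫⁻ u, L (update x k u) ∂μ ∂π := by
        rw [hins]
        refine (lintegral_lintegral_update μ k (hEm.mul hinsm)).symm.trans ?_
        refine lintegral_congr fun x => ?_
        simp only [update_idem, Pi.mul_apply]
        have hm : Measurable fun s => E.indicator (1 : (ι → ℝ) → ℝ≥0∞) (update x k s) :=
          hEm.comp (measurable_update x)
        rw [lintegral_mul_const _ hm, lineFraction_eq_lintegral μ hE]
      have e2 : ∫⁻ x, lineFraction μ E k x * ∫⁻ u, L (update x k u) ∂μ ∂π =
          ∫⁻ x, lineFraction μ E k x * L x ∂π := by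
        refine Eq.trans ?_ (lintegral_lintegral_update μ k ((measurable_lineFraction μ hE k).mul hLm))
        refine lintegral_congr fun x => ?_
        simp only [lineFraction_update]
        have hm : Measurable fun s => L (update x k s) := hLm.comp (measurable_update x)
        rw [lintegral_const_mul _ hm]
      have e3 : ∫⁻ x, lineFraction μ E k x * L x ∂π ≤
          ∫⁻ x, (E.indicator 1 x * L x + (mixedLines μ E k).indicator 1 x) ∂π := by
        refine lintegral_mono_ae ?_
        filter_upwards [ae_lineFraction_le μ hE k] with x hx
        calc lineFraction μ E k x * L x
            ≤ (E.indicator 1 x + (mixedLines μ E k).indicator 1 x) * L x := by gcongr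
          _ = E.indicator 1 x * L x + (mixedLines μ E k).indicator 1 x * L x := add_mul _ _ _
          _ ≤ E.indicator 1 x * L x + (mixedLines μ E k).indicator 1 x * 1 := by
              gcongr; exact hL1 s x
          _ = _ := by rw [mul_one]
      rw [e1, e2, Finset.sum_insert hk, add_comm (π _)]
      refine e3.trans ?_
      rw [lintegral_add_right _ (measurable_one.indicator (measurableSet_mixedLines μ hE k)),
        lintegral_indicator_one (measurableSet_mixedLines μ hE k)]
      gcongr
  have h := key Finset.univ
  have e : ∀ x, (∫⋯∫⁻_Finset.univ, g ∂fun _ => μ) x = π Eᶜ := by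
    intro x
    rw [lmarginal_univ, hg, lintegral_indicator_one hE.compl]
  simp_rw [e] at h
  rwa [lintegral_mul_const _ (measurable_one.indicator hE), lintegral_indicator_one hE] at h

/-- A Loomis-Whitney type inequality for the lines meeting `E`. -/
theorem measure_le_rpow {E : Set (ι → ℝ)} (hE : MeasurableSet E) {p : ℝ}
    (hp : Real.HolderConjugate (Fintype.card ι) p) :
    (Measure.pi fun _ : ι => μ) E ≤
      (∑ i, (Measure.pi fun _ : ι => μ) (mixedLines μ E i) +
        Fintype.card ι * (Measure.pi fun _ : ι => μ) E) ^ p := by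
  set π := Measure.pi fun _ : ι => μ with hπ
  set H : ι → Set (ι → ℝ) := fun i => {y | lineFraction μ E i y ≠ 0} with hH
  have hHm : ∀ i, MeasurableSet (H i) := fun i =>
    measurable_lineFraction μ hE i (measurableSet_singleton 0).compl
  set f : (ι → ℝ) → ℝ≥0∞ := fun y => ∑ i, (H i).indicator 1 y with hf
  have hfm : Measurable f := Finset.measurable_sum _ fun i _ => measurable_one.indicator (hHm i)
  have hLW := lintegral_prod_lintegral_pow_le (fun _ : ι => μ) hp hfm
  have hlow : π E ≤ ∫⁻ x, ∏ i, (∫⁻ s, f (update x i s) ∂μ) ^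
      ((1 : ℝ) / ((Fintype.card ι : ℝ) - 1)) ∂π := by
    rw [← lintegral_indicator_one hE]
    refine lintegral_mono_ae ?_
    have : ∀ᵐ y ∂π, ∀ i, y ∈ E → lineFraction μ E i y ≠ 0 :=
      ae_all_iff.2 fun i => ae_lineFraction_ne_zero μ hE i
    filter_upwards [this] with y hy
    by_cases hyE : y ∈ E
    · rw [indicator_of_mem hyE, Pi.one_apply]
      refine Finset.one_le_prod' fun i _ => ?_
      have h1 : 1 ≤ ∫⁻ s, f (update y i s) ∂μ := by
        calc (1 : ℝ≥0∞) = ∫⁻ _, 1 ∂μ := by simp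
          _ ≤ ∫⁻ s, f (update y i s) ∂μ := by
            refine lintegral_mono fun s => ?_
            have hmem : update y i s ∈ H i := by
              simp only [hH, mem_ofPred_eq, lineFraction_update]
              exact hy i hyE
            calc (1 : ℝ≥0∞) = (H i).indicator 1 (update y i s) := by
                  rw [indicator_of_mem hmem]; rfl
              _ ≤ f (update y i s) := Finset.single_le_sum
                  (f := fun j => (H j).indicator (1 : (ι → ℝ) → ℝ≥0∞) (update y i s))
                  (fun _ _ => zero_le) (Finset.mem_univ i)
      refine ENNReal.one_le_rpow h1 ?_
      have := hp.lt
      exact one_div_pos.2 (by linarith)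
    · simp [hyE]
  refine hlow.trans (hLW.trans (ENNReal.rpow_le_rpow ?_ hp.symm.nonneg))
  have hsum : ∫⁻ x, f x ∂π = ∑ i, π (H i) := by
    rw [hf, lintegral_finsetSum _ fun i _ => measurable_one.indicator (hHm i)]
    exact Finset.sum_congr rfl fun i _ => lintegral_indicator_one (hHm i)
  rw [hsum]
  calc ∑ i, π (H i) ≤ ∑ i, (π (mixedLines μ E i) + π E) := by
        refine Finset.sum_le_sum fun i _ => ?_
        rw [← lintegral_lineFraction μ hE i, ← lintegral_indicator_one (hHm i),
          ← lintegral_indicator_one (measurableSet_mixedLines μ hE i),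
          ← lintegral_add_left (measurable_one.indicator (measurableSet_mixedLines μ hE i))]
        refine lintegral_mono fun y => ?_
        by_cases hy : y ∈ H i
        · rw [indicator_of_mem hy]
          by_cases hy' : y ∈ mixedLines μ E i
          · rw [indicator_of_mem hy']; exact le_self_add
          · have h0 : lineFraction μ Eᶜ i y = 0 := by
              by_contra h; exact hy' ⟨hy, h⟩
            have := lineFraction_add_compl μ hE i y
            rw [h0, add_zero] at this
            rw [this]; exact le_add_self
        · simp [hy]
    _ = _ := by simp [Finset.sum_add_distrib]

end Cube

/-- An isoperimetric inequality on the cube for sets of small measure. -/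
theorem exists_rpow_le_mixedLines (n : ℕ) (hn : 1 ≤ n) :
    ∃ α δ : ℝ, 0 < α ∧ α < 1 ∧ 0 < δ ∧ δ ≤ 1 / 4 ∧
      ∀ (μ : Measure ℝ) [IsProbabilityMeasure μ] (E : Set (Fin n → ℝ)), MeasurableSet E →
        ((Measure.pi fun _ : Fin n => μ) E).toReal ≤ δ →
        ((Measure.pi fun _ : Fin n => μ) E).toReal ^ α ≤
          2 * (∑ i, (Measure.pi fun _ : Fin n => μ) (mixedLines μ E i)).toReal := by
  rcases hn.eq_or_lt with rfl | hn
  · refine ⟨1 / 2, 1 / 4, by norm_num, by norm_num, by norm_num, le_rfl, ?_⟩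
    intro μ _ E hE hf
    set π := Measure.pi fun _ : Fin 1 => μ with hπ
    rcases eq_or_ne (π E) 0 with h0 | h0
    · simp [h0]
    have hc : π Eᶜ ≠ 0 := by
      rw [Ne, prob_compl_eq_zero_iff hE]
      intro h1
      rw [h1] at hf
      norm_num at hf
    have hm := measure_mul_measure_compl_le μ hE
    have hne : π (mixedLines μ E 0) ≠ 0 := by
      intro h
      rw [Fin.sum_univ_one, h] at hm
      exact mul_ne_zero h0 hc (le_antisymm hm zero_le)
    have huniv : mixedLines μ E 0 = univ := by
      obtain ⟨y, hy⟩ := nonempty_of_measure_ne_zero hne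
      refine eq_univ_of_forall fun y' => ?_
      have e : ∀ s, update y' 0 s = update y 0 s := by
        intro s; ext i; fin_cases i; simp
      simpa only [mixedLines, lineFraction, mem_ofPred_eq, e] using hy
    rw [Fin.sum_univ_one, huniv, measure_univ]
    have : (π E).toReal ^ (1 / 2 : ℝ) ≤ 1 :=
      Real.rpow_le_one ENNReal.toReal_nonneg (by linarith) (by norm_num)
    simp only [ENNReal.toReal_one]
    linarith
  · have hn1 : (1 : ℝ) < n := by exact_mod_cast hn
    have hn2 : (2 : ℝ) ≤ n := by exact_mod_cast hn
    have hn0 : (0 : ℝ) < n := by linarith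
    set c : ℝ := 1 / (2 * n) with hc
    have hc0 : 0 < c := by positivity
    have hc4 : c ≤ 1 / 4 := one_div_le_one_div_of_le (by norm_num) (by linarith)
    refine ⟨1 - 1 / n, c ^ n, ?_, ?_, by positivity, ?_, ?_⟩
    · rw [sub_pos, div_lt_one hn0]; exact hn1
    · have : 0 < 1 / (n : ℝ) := by positivity
      linarith
    · exact (pow_le_of_le_one hc0.le (by linarith) (by omega)).trans hc4
    intro μ _ E hE hf
    set π := Measure.pi fun _ : Fin n => μ with hπ
    set f := (π E).toReal with hfdef
    set m := (∑ i, π (mixedLines μ E i)).toReal with hm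
    have hf0 : 0 ≤ f := ENNReal.toReal_nonneg
    have hmfin : ∑ i, π (mixedLines μ E i) ≠ ∞ :=
      ENNReal.sum_ne_top.2 fun i _ => measure_ne_top _ _
    have hp : Real.HolderConjugate (Fintype.card (Fin n)) (n / (n - 1)) := by
      rw [Fintype.card_fin]
      exact Real.HolderConjugate.conjExponent hn1
    have hLW := measure_le_rpow μ hE hp
    have hreal : f ≤ (m + n * f) ^ ((n : ℝ) / (n - 1)) := by
      have := ENNReal.toReal_mono ?_ hLW
      · rw [← ENNReal.toReal_rpow, ENNReal.toReal_add hmfin ?_, ENNReal.toReal_mul] at this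
        · simpa using this
        · exact ENNReal.mul_ne_top (by simp) (measure_ne_top _ _)
      · refine ENNReal.rpow_ne_top_of_nonneg hp.symm.nonneg ?_
        exact ENNReal.add_ne_top.2 ⟨hmfin, ENNReal.mul_ne_top (by simp) (measure_ne_top _ _)⟩
    have hα0 : 0 ≤ 1 - 1 / (n : ℝ) := by
      rw [sub_nonneg, div_le_one hn0]; exact hn1.le
    have hm0 : 0 ≤ m := ENNReal.toReal_nonneg
    have h1 : f ^ (1 - 1 / (n : ℝ)) ≤ m + n * f := by
      calc f ^ (1 - 1 / (n : ℝ)) ≤ ((m + n * f) ^ ((n : ℝ) / (n - 1))) ^ (1 - 1 / (n : ℝ)) :=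
            Real.rpow_le_rpow hf0 hreal hα0
        _ = m + n * f := by
            rw [← Real.rpow_mul (by positivity)]
            have : (n : ℝ) / (n - 1) * (1 - 1 / n) = 1 := by
              have : (n : ℝ) - 1 ≠ 0 := by linarith
              field_simp
            rw [this, Real.rpow_one]
    have h2 : f ^ (1 / (n : ℝ)) ≤ c := by
      calc f ^ (1 / (n : ℝ)) ≤ (c ^ n) ^ (1 / (n : ℝ)) :=
            Real.rpow_le_rpow hf0 hf (by positivity)
        _ = c := by
            rw [one_div]; exact Real.pow_rpow_inv_natCast hc0.le (by omega)
    have h3 : n * f ≤ f ^ (1 - 1 / (n : ℝ)) / 2 := by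
      have e : f = f ^ (1 / (n : ℝ)) * f ^ (1 - 1 / (n : ℝ)) := by
        rw [← Real.rpow_add_of_nonneg hf0 (by positivity) hα0]; simp
      have h4 : f ≤ c * f ^ (1 - 1 / (n : ℝ)) := by
        nth_rewrite 1 [e]
        exact mul_le_mul_of_nonneg_right h2 (Real.rpow_nonneg hf0 _)
      calc n * f ≤ n * (c * f ^ (1 - 1 / (n : ℝ))) := by gcongr
        _ = f ^ (1 - 1 / (n : ℝ)) / 2 := by rw [hc]; field_simp
    linarith

end LongCuboid

namespace LongCuboid

lemma volume_le_of_forall_inter_Icc_le {A : Set ℝ} (hA : MeasurableSet A) {c : ℝ≥0∞}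
    (h : ∀ s ∈ A, ∀ t ∈ A, s ≤ t → volume (A ∩ Icc s t) ≤ c) : volume A ≤ c := by
  rw [hA.measure_eq_iSup_isCompact]
  refine iSup₂_le fun K hKA => iSup_le fun hK => ?_
  rcases K.eq_empty_or_nonempty with rfl | hne
  · simp
  have hs := hK.sInf_mem hne
  have ht := hK.sSup_mem hne
  have hsub : K ⊆ Icc (sInf K) (sSup K) := fun x hx =>
    ⟨csInf_le hK.bddBelow hx, le_csSup hK.bddAbove hx⟩
  exact (measure_mono (subset_inter hKA hsub)).trans (h _ (hKA hs) _ (hKA ht) (hsub hs).2)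

/-- The constant in `volume_le_of_growth`. -/
noncomputable def growthConst (α : ℝ) : ℝ :=
  ((1 / 2 : ℝ) ^ α)⁻¹ * (1 - (2 * (1 / 2 : ℝ) ^ α)⁻¹)⁻¹

lemma half_lt_half_rpow {α : ℝ} (hα1 : α < 1) : 1 / 2 < (1 / 2 : ℝ) ^ α := by
  have := Real.rpow_lt_rpow_of_exponent_gt (show (0 : ℝ) < 1 / 2 by norm_num) (by norm_num) hα1
  rwa [Real.rpow_one] at this

lemma growthConst_nonneg {α : ℝ} (hα1 : α < 1) : 0 ≤ growthConst α := by
  have hb := half_lt_half_rpow hα1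
  refine mul_nonneg (by positivity) (inv_nonneg.2 (sub_nonneg.2 (inv_le_one_of_one_le₀ ?_)))
  linarith

/-- A function that satisfies the integral form of the differential inequality `F' ≥ F ^ α / C` on
a set `X` with `α < 1` and stays bounded forces `X` to have bounded measure. -/
lemma volume_le_of_growth {α C : ℝ} (hα0 : 0 < α) (hα1 : α < 1) (hC : 0 ≤ C) {X : Set ℝ}
    (hX : MeasurableSet X) {F : ℝ → ℝ} (hF : Monotone F) (h0 : ∀ t ∈ X, 0 ≤ F t)
    (h1 : ∀ t ∈ X, F t ≤ 1)
    (hgrow : ∀ s ∈ X, ∀ t ∈ X, s ≤ t →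
      ENNReal.ofReal (F s ^ α) * volume (X ∩ Icc s t) ≤ ENNReal.ofReal (C * F t))
    (hpos : ∀ t ∈ X, F t = 0 → volume (X ∩ Iic t) = 0) :
    volume X ≤ ENNReal.ofReal (C * growthConst α) := by
  set b : ℝ := (1 / 2 : ℝ) ^ α with hb
  have hbh : 1 / 2 < b := half_lt_half_rpow hα1
  have hb0 : 0 < b := by linarith
  set q : ℝ := (2 * b)⁻¹ with hq
  have hq0 : 0 < q := by positivity
  have hq1 : q < 1 := inv_lt_one_of_one_lt₀ (by linarith)
  have hz : volume (X ∩ F ⁻¹' {0}) ≤ 0 := by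
    refine volume_le_of_forall_inter_Icc_le (hX.inter (hF.measurable (measurableSet_singleton 0)))
      fun s _ t ht _ => ?_
    rw [← hpos t ht.1 ht.2]
    exact measure_mono fun x hx => ⟨hx.1.1, hx.2.2⟩
  have hk : ∀ k : ℕ, volume (X ∩ F ⁻¹' (Ioc ((1 / 2 : ℝ) ^ (k + 1)) ((1 / 2) ^ k))) ≤
      ENNReal.ofReal (C * b⁻¹) * ENNReal.ofReal q ^ k := by
    intro k
    refine volume_le_of_forall_inter_Icc_le (hX.inter (hF.measurable measurableSet_Ioc))
      fun s hs t ht hst => ?_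
    have hg := hgrow s hs.1 t ht.1 hst
    have hbs : b ^ (k + 1) ≤ F s ^ α := by
      calc b ^ (k + 1) = ((1 / 2 : ℝ) ^ (k + 1)) ^ α := by
            rw [hb, ← Real.rpow_natCast, ← Real.rpow_mul (by norm_num), mul_comm,
              Real.rpow_mul (by norm_num), Real.rpow_natCast]
        _ ≤ F s ^ α := Real.rpow_le_rpow (by positivity) hs.2.1.le hα0.le
    have hbp : 0 < b ^ (k + 1) := by positivity
    have h2 : ENNReal.ofReal (b ^ (k + 1)) * volume (X ∩ Icc s t) ≤
        ENNReal.ofReal (C * (1 / 2) ^ k) := by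
      calc _ ≤ ENNReal.ofReal (F s ^ α) * volume (X ∩ Icc s t) := by gcongr
        _ ≤ _ := hg
        _ ≤ _ := by gcongr; exact ht.2.2
    calc volume (X ∩ F ⁻¹' (Ioc ((1 / 2 : ℝ) ^ (k + 1)) ((1 / 2) ^ k)) ∩ Icc s t)
        ≤ volume (X ∩ Icc s t) := measure_mono fun x hx => ⟨hx.1.1, hx.2⟩
      _ ≤ ENNReal.ofReal (C * (1 / 2) ^ k) / ENNReal.ofReal (b ^ (k + 1)) := by
          rw [ENNReal.le_div_iff_mul_le (Or.inl (by simpa using hbp)) (Or.inl (by simp)), mul_comm]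
          exact h2
      _ = ENNReal.ofReal (C * b⁻¹ * q ^ k) := by
          rw [← ENNReal.ofReal_div_of_pos hbp]
          congr 1
          rw [hq, inv_pow, mul_pow, pow_succ, one_div, inv_pow]
          field_simp
      _ = _ := by rw [ENNReal.ofReal_mul (by positivity), ENNReal.ofReal_pow hq0.le]
  have hcov : X ⊆ (X ∩ F ⁻¹' {0}) ∪
      ⋃ k : ℕ, X ∩ F ⁻¹' (Ioc ((1 / 2 : ℝ) ^ (k + 1)) ((1 / 2) ^ k)) := by
    intro t ht
    rcases (h0 t ht).eq_or_lt with h | h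
    · exact Or.inl ⟨ht, h.symm⟩
    · obtain ⟨k, hk1, hk2⟩ := exists_nat_pow_near_of_lt_one h (h1 t ht)
        (show (0 : ℝ) < 1 / 2 by norm_num) (by norm_num)
      exact Or.inr (mem_iUnion.2 ⟨k, ht, hk1, hk2⟩)
  calc volume X ≤ volume (X ∩ F ⁻¹' {0}) +
        volume (⋃ k : ℕ, X ∩ F ⁻¹' (Ioc ((1 / 2 : ℝ) ^ (k + 1)) ((1 / 2) ^ k))) :=
        (measure_mono hcov).trans (measure_union_le _ _)
    _ ≤ 0 + ∑' k : ℕ, ENNReal.ofReal (C * b⁻¹) * ENNReal.ofReal q ^ k :=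
        add_le_add hz ((measure_iUnion_le _).trans (ENNReal.tsum_le_tsum hk))
    _ = ENNReal.ofReal (C * growthConst α) := by
        rw [zero_add, ENNReal.tsum_mul_left, ENNReal.tsum_geometric, ← ENNReal.ofReal_one,
          ← ENNReal.ofReal_sub _ hq0.le, ← ENNReal.ofReal_inv_of_pos (by linarith),
          ← ENNReal.ofReal_mul (by positivity), mul_assoc]
        rfl

lemma exists_le_measure_Iio {α N : ℝ} (hα0 : 0 < α) (hα1 : α < 1) (hN : 0 ≤ N) {f m : ℝ → ℝ}
    {ν : Measure ℝ} [IsFiniteMeasure ν] (hν : ν.real univ ≤ 1)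
    {X : Set ℝ} (hX : MeasurableSet X) (hm : Measurable m)
    (hfm : ∀ t ∈ X, f t ^ α ≤ 2 * m t)
    (hint : ∀ T, MeasurableSet T → T ⊆ X →
      ∫⁻ t in T, ENNReal.ofReal (m t) ≤ ENNReal.ofReal N * ν T)
    (hvol : ENNReal.ofReal (2 * N * growthConst α) < volume X) :
    ∃ t ∈ X, f t ≤ ν.real (Iio t) := by
  by_contra! hcon
  set F : ℝ → ℝ := fun t => ν.real (Iio t) with hFdef
  have hF : Monotone F := fun s t hst => measureReal_mono (Iio_subset_Iio hst)
  have hF0 : ∀ t, 0 ≤ F t := fun t => measureReal_nonneg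
  have hmul : ∀ T, MeasurableSet T → T ⊆ X → ∀ t, T ⊆ Iio t →
      ∫⁻ t in T, ENNReal.ofReal (2 * m t) ≤ ENNReal.ofReal (2 * N * F t) := by
    intro T hT hTX t hTt
    have e : ∀ t, ENNReal.ofReal (2 * m t) = ENNReal.ofReal 2 * ENNReal.ofReal (m t) :=
      fun t => ENNReal.ofReal_mul (by norm_num)
    simp_rw [e]
    rw [lintegral_const_mul _ (by fun_prop), ENNReal.ofReal_mul (by positivity),
      ENNReal.ofReal_mul (by norm_num), mul_assoc]
    gcongr
    refine (hint T hT hTX).trans ?_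
    gcongr
    rw [hFdef, ofReal_measureReal]
    exact measure_mono hTt
  refine absurd (volume_le_of_growth hα0 hα1 (show 0 ≤ 2 * N by positivity) hX hF
    (fun t _ => hF0 t) (fun t _ => (measureReal_mono (subset_univ _)).trans hν) ?_ ?_)
    (not_le.2 hvol)
  · intro s hs t ht hst
    have hae : volume (X ∩ Icc s t) = volume (X ∩ Ico s t) :=
      measure_congr ((ae_eq_refl X).inter Ico_ae_eq_Icc.symm)
    rw [hae]
    calc ENNReal.ofReal (F s ^ α) * volume (X ∩ Ico s t)
        = ∫⁻ _ in X ∩ Ico s t, ENNReal.ofReal (F s ^ α) := by simp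
      _ ≤ ∫⁻ u in X ∩ Ico s t, ENNReal.ofReal (2 * m u) := by
          refine setLIntegral_mono' (hX.inter measurableSet_Ico) fun u hu => ?_
          refine ENNReal.ofReal_le_ofReal (le_trans ?_ (hfm u hu.1))
          exact Real.rpow_le_rpow (hF0 s) ((hF hu.2.1).trans (hcon u hu.1).le) hα0.le
      _ ≤ _ := hmul _ (hX.inter measurableSet_Ico) inter_subset_left t fun u hu => hu.2.2
  · intro t ht hFt
    have hae : volume (X ∩ Iic t) = volume (X ∩ Iio t) :=
      measure_congr ((ae_eq_refl X).inter Iio_ae_eq_Iic.symm)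
    rw [hae]
    have h := hmul _ (hX.inter (measurableSet_Iio (a := t))) inter_subset_left t fun u hu => hu.2
    rw [hFt, mul_zero, ENNReal.ofReal_zero, nonpos_iff_eq_zero,
      setLIntegral_eq_zero_iff (hX.inter measurableSet_Iio) (by fun_prop)] at h
    refine measure_mono_null (fun u hu => ?_) h
    simp only [mem_compl_iff, mem_ofPred_eq, Classical.not_imp]
    refine ⟨hu, ?_⟩
    have hpos : 0 < f u := (hF0 u).trans_lt (hcon u hu.1)
    have := (Real.rpow_pos_of_pos hpos α).trans_le (hfm u hu.1)
    simpa using this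

lemma exists_le_measure_Ioi {α N : ℝ} (hα0 : 0 < α) (hα1 : α < 1) (hN : 0 ≤ N) {f m : ℝ → ℝ}
    {ν : Measure ℝ} [IsFiniteMeasure ν] (hν : ν.real univ ≤ 1)
    {X : Set ℝ} (hX : MeasurableSet X) (hm : Measurable m)
    (hfm : ∀ t ∈ X, f t ^ α ≤ 2 * m t)
    (hint : ∀ T, MeasurableSet T → T ⊆ X →
      ∫⁻ t in T, ENNReal.ofReal (m t) ≤ ENNReal.ofReal N * ν T)
    (hvol : ENNReal.ofReal (2 * N * growthConst α) < volume X) :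
    ∃ t ∈ X, f t ≤ ν.real (Ioi t) := by
  have hmp : MeasurePreserving (Neg.neg : ℝ → ℝ) := Measure.measurePreserving_neg volume
  have hmap : ∀ T, MeasurableSet T → (ν.map Neg.neg) T = ν (Neg.neg ⁻¹' T) :=
    fun T hT => Measure.map_apply measurable_neg hT
  obtain ⟨t, ht, h⟩ := exists_le_measure_Iio (f := fun t => f (-t)) (m := fun t => m (-t))
    (ν := ν.map Neg.neg) (X := Neg.neg ⁻¹' X) hα0 hα1 hN
    (by rw [measureReal_def, hmap _ MeasurableSet.univ]; exact hν)
    (measurable_neg hX) (hm.comp measurable_neg) (fun t ht => hfm _ ht)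
    (fun T hT hTX => by
      have h := hint (Neg.neg ⁻¹' T) (measurable_neg hT)
        (fun t ht => by simpa using hTX ht)
      rw [hmap T hT]
      refine le_trans (le_of_eq ?_) h
      have e := hmp.setLIntegral_comp_preimage (measurable_neg hT)
        (f := fun t => ENNReal.ofReal (m t)) (by fun_prop)
      rw [← e]
      simp)
    (by rwa [hmp.measure_preimage hX.nullMeasurableSet])
  refine ⟨-t, ht, ?_⟩
  rw [measureReal_def, hmap _ measurableSet_Iio] at h
  have e : Neg.neg ⁻¹' Iio t = Ioi (-t) := by
    ext x
    simp only [mem_Ioi, mem_preimage, mem_Iio]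
    exact neg_lt
  rwa [e] at h

/-- If `f` is small on a large set to the left and close to one on a large set to the right, then
`ν` has total mass at least one. -/
lemma one_le_measureReal_of_crossing {α N : ℝ} (hα0 : 0 < α) (hα1 : α < 1) (hN : 0 ≤ N)
    {f m : ℝ → ℝ} {ν : Measure ℝ} [IsFiniteMeasure ν] (hm : Measurable m) {p : ℝ} {X Y : Set ℝ}
    (hX : MeasurableSet X) (hY : MeasurableSet Y) (hXp : X ⊆ Iio p) (hYp : Y ⊆ Ioi p)
    (hfX : ∀ t ∈ X, f t ^ α ≤ 2 * m t) (hfY : ∀ t ∈ Y, (1 - f t) ^ α ≤ 2 * m t)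
    (hint : ∀ T, MeasurableSet T → T ⊆ X ∪ Y →
      ∫⁻ t in T, ENNReal.ofReal (m t) ≤ ENNReal.ofReal N * ν T)
    (hosc : ∀ s ∈ X, ∀ t ∈ Y, |f s - f t| ≤ ν.real (Icc s t))
    (hvX : ENNReal.ofReal (2 * N * growthConst α) < volume X)
    (hvY : ENNReal.ofReal (2 * N * growthConst α) < volume Y) : 1 ≤ ν.real univ := by
  by_contra! hlt
  obtain ⟨s, hs, hfs⟩ := exists_le_measure_Iio hα0 hα1 hN hlt.le hX hm hfX
    (fun T hT hTX => hint T hT (hTX.trans subset_union_left)) hvX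
  obtain ⟨t, ht, hft⟩ := exists_le_measure_Ioi (f := fun t => 1 - f t) hα0 hα1 hN hlt.le hY hm hfY
    (fun T hT hTX => hint T hT (hTX.trans subset_union_right)) hvY
  have hst : s < t := (hXp hs).trans (hYp ht)
  have h1 : ν.real (Iio s ∪ Icc s t ∪ Ioi t) =
      ν.real (Iio s) + ν.real (Icc s t) + ν.real (Ioi t) := by
    rw [measureReal_union _ measurableSet_Ioi, measureReal_union _ measurableSet_Icc]
    · exact disjoint_left.2 fun x hx hx' => absurd hx'.1 (not_le.2 hx)
    · refine disjoint_left.2 fun x hx hx' => ?_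
      rcases hx with hx | hx
      · exact absurd (hst.trans hx') (not_lt.2 (le_of_lt hx))
      · exact absurd hx.2 (not_le.2 hx')
  have h2 : ν.real (Iio s ∪ Icc s t ∪ Ioi t) ≤ ν.real univ := measureReal_mono (subset_univ _)
  have h3 := hosc s hs t ht
  rw [abs_le] at h3
  linarith [h3.1]

lemma exists_median {l : ℝ} {X : Set ℝ} (hX : MeasurableSet X) (hXl : X ⊆ Ioo (-l) l) :
    ∃ p, volume.real (X ∩ Iio p) = volume.real X / 2 ∧
      volume.real (X ∩ Ioi p) = volume.real X / 2 := by
  have hfin : volume X ≠ ∞ := measure_ne_top_of_subset hXl (by simp)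
  have hfin' : ∀ T, volume (X ∩ T) ≠ ∞ := fun T => measure_ne_top_of_subset inter_subset_left hfin
  set g : ℝ → ℝ := fun t => volume.real (X ∩ Iio t) with hg
  rcases X.eq_empty_or_nonempty with rfl | ⟨x, hx⟩
  · exact ⟨0, by simp⟩
  have hll : -l ≤ l := ((hXl hx).1.trans (hXl hx).2).le
  have hcont : Continuous g := by
    have hstep : ∀ s t, s ≤ t → g t ≤ g s + (t - s) := by
      intro s t hst
      have : X ∩ Iio t ⊆ (X ∩ Iio s) ∪ Ico s t := by
        intro x hx
        rcases lt_or_ge x s with h | h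
        · exact Or.inl ⟨hx.1, h⟩
        · exact Or.inr ⟨h, hx.2⟩
      calc g t ≤ volume.real ((X ∩ Iio s) ∪ Ico s t) :=
            measureReal_mono this (measure_union_ne_top (hfin' _) (by simp))
        _ ≤ g s + volume.real (Ico s t) := measureReal_union_le _ _
        _ = g s + (t - s) := by rw [Real.volume_real_Ico_of_le hst]
    have hmono : Monotone g := fun s t hst =>
      measureReal_mono (inter_subset_inter_right _ (Iio_subset_Iio hst)) (hfin' _)
    have hlip : LipschitzWith 1 g := by
      refine LipschitzWith.of_dist_le_mul fun s t => ?_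
      rw [NNReal.coe_one, one_mul, Real.dist_eq, Real.dist_eq]
      rcases le_total s t with h | h
      · rw [abs_sub_comm, abs_of_nonneg (sub_nonneg.2 (hmono h)), abs_sub_comm,
          abs_of_nonneg (sub_nonneg.2 h)]
        linarith [hstep s t h]
      · rw [abs_of_nonneg (sub_nonneg.2 (hmono h)), abs_of_nonneg (sub_nonneg.2 h)]
        linarith [hstep t s h]
    exact hlip.continuous
  have hgl : g (-l) = 0 := by
    have : X ∩ Iio (-l) = ∅ := eq_empty_of_forall_notMem fun x hx => lt_asymm (hXl hx.1).1 hx.2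
    simp [hg, this]
  have hgr : g l = volume.real X := by
    have : X ∩ Iio l = X := inter_eq_left.2 fun x hx => (hXl hx).2
    simp [hg, this]
  have hX0 : 0 ≤ volume.real X := measureReal_nonneg
  obtain ⟨p, -, hp⟩ := intermediate_value_Icc hll hcont.continuousOn
    (show volume.real X / 2 ∈ Icc (g (-l)) (g l) by rw [hgl, hgr]; constructor <;> linarith)
  refine ⟨p, hp, ?_⟩
  have hae : volume.real (X ∩ Ioi p) = volume.real (X \ Iio p) := by
    rw [sdiff_eq, compl_Iio]
    exact measureReal_congr ((ae_eq_refl X).inter Ioi_ae_eq_Ici)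
  have := measureReal_inter_add_sdiff (μ := volume) (s := X) (measurableSet_Iio (a := p)) hfin
  rw [hae]
  have hp' : volume.real (X ∩ Iio p) = volume.real X / 2 := hp
  linarith

end LongCuboid

namespace LongCuboid

lemma setLIntegral_ofReal_le {L X X₁ : Set ℝ} (hL : MeasurableSet L) (hX : MeasurableSet X)
    (hX₁ : MeasurableSet X₁) {f m : ℝ → ℝ} (hm : Measurable m)
    (hf1 : ∀ t, f t ≤ 1) (hfm : ∀ t ∈ X, t ∉ X₁ → f t ≤ 2 * m t) {a N : ℝ}
    (ha : volume (L \ X) ≤ ENNReal.ofReal a)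
    (hint : ∫⁻ t in L, ENNReal.ofReal (m t) ≤ ENNReal.ofReal N) :
    ∫⁻ t in L, ENNReal.ofReal (f t) ≤
      ENNReal.ofReal a + volume X₁ + ENNReal.ofReal (2 * N) := by
  have hone : ∀ S : Set ℝ, MeasurableSet S → Measurable (S.indicator (1 : ℝ → ℝ≥0∞)) :=
    fun S hS => measurable_one.indicator hS
  calc ∫⁻ t in L, ENNReal.ofReal (f t)
      ≤ ∫⁻ t in L, ((L \ X).indicator 1 t + X₁.indicator 1 t + ENNReal.ofReal (2 * m t)) := by
        refine setLIntegral_mono' hL fun t ht => ?_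
        have h1 : ENNReal.ofReal (f t) ≤ 1 := by
          rw [← ENNReal.ofReal_one]; exact ENNReal.ofReal_le_ofReal (hf1 t)
        by_cases htX : t ∈ X
        · by_cases ht1 : t ∈ X₁
          · rw [indicator_of_mem ht1, Pi.one_apply]
            exact h1.trans (le_add_self.trans le_self_add)
          · exact (ENNReal.ofReal_le_ofReal (hfm t htX ht1)).trans le_add_self
        · rw [indicator_of_mem (show t ∈ L \ X from ⟨ht, htX⟩), Pi.one_apply, add_assoc]
          exact h1.trans le_self_add
    _ = (∫⁻ t in L, (L \ X).indicator 1 t) + (∫⁻ t in L, X₁.indicator 1 t) +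
          ∫⁻ t in L, ENNReal.ofReal (2 * m t) := by
        rw [lintegral_add_right _ (by fun_prop), lintegral_add_left (hone _ (hL.diff hX))]
    _ ≤ _ := by
        gcongr
        · refine (setLIntegral_le_lintegral _ _).trans ?_
          rwa [lintegral_indicator_one (hL.diff hX)]
        · refine (setLIntegral_le_lintegral _ _).trans ?_
          rw [lintegral_indicator_one hX₁]
        · have e : ∀ t, ENNReal.ofReal (2 * m t) = ENNReal.ofReal 2 * ENNReal.ofReal (m t) :=
            fun t => ENNReal.ofReal_mul (by norm_num)
          simp_rw [e]
          rw [lintegral_const_mul _ (by fun_prop), ENNReal.ofReal_mul (by norm_num)]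
          gcongr

lemma min_setLIntegral_le_of_small {N l : ℝ} (hN : 1 ≤ N) (hl : 1 ≤ l) {f m : ℝ → ℝ}
    {ν : Measure ℝ} [IsFiniteMeasure ν] {R : Set ℝ} (hR : volume (Ioo (-l) l \ R) = 0)
    (hm : Measurable m) (hf0 : ∀ t, 0 ≤ f t) (hf1 : ∀ t, f t ≤ 1)
    (hfm : ∀ t, f t * (1 - f t) ≤ m t)
    (hint : ∫⁻ t in Ioo (-l) l, ENNReal.ofReal (m t) ≤ ENNReal.ofReal N * ν univ)
    (hosc : ∀ s ∈ R, ∀ t ∈ R, s < t → |f s - f t| ≤ ν.real univ)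
    (hsmall : ν.real univ ≤ 1 / (16 * N)) :
    min (∫⁻ t in Ioo (-l) l, ENNReal.ofReal (f t))
      (∫⁻ t in Ioo (-l) l, ENNReal.ofReal (1 - f t)) ≤ ENNReal.ofReal (2 * N) * ν univ := by
  have hNh : N * ν.real univ ≤ 1 / 16 := by
    calc N * ν.real univ ≤ N * (1 / (16 * N)) := by gcongr
      _ = 1 / 16 := by field_simp
  have hh : ν.real univ ≤ 1 / 16 := by
    have : 0 ≤ ν.real univ := measureReal_nonneg
    nlinarith
  have hRae : ∀ᵐ t ∂volume.restrict (Ioo (-l) l), t ∈ R := by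
    rw [ae_restrict_iff' measurableSet_Ioo]
    refine measure_mono_null (fun t ht => ?_) hR
    simp only [mem_compl_iff, mem_ofPred_eq, Classical.not_imp] at ht
    exact ht
  have hosc' : ∀ s ∈ R, ∀ t ∈ R, |f s - f t| ≤ 1 / 16 := by
    intro s hs t ht
    rcases lt_trichotomy s t with h | rfl | h
    · exact (hosc s hs t ht h).trans hh
    · simp
    · rw [abs_sub_comm]; exact (hosc t ht s hs h).trans hh
  have hex : ∃ t ∈ R, m t ≤ 1 / 16 := by
    by_contra! hcon
    have h1 : ∫⁻ _ in Ioo (-l) l, ENNReal.ofReal (1 / 16) ≤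
        ∫⁻ t in Ioo (-l) l, ENNReal.ofReal (m t) := by
      refine lintegral_mono_ae ?_
      filter_upwards [hRae] with t ht
      exact ENNReal.ofReal_le_ofReal (hcon t ht).le
    have h2 := h1.trans hint
    rw [setLIntegral_const, Real.volume_Ioo, ← ofReal_measureReal (μ := ν) (s := univ),
      ← ENNReal.ofReal_mul (by norm_num), ← ENNReal.ofReal_mul (by linarith),
      ENNReal.ofReal_le_ofReal_iff (by positivity)] at h2
    linarith
  obtain ⟨t₀, ht₀, hmt₀⟩ := hex
  have hft₀ := (hfm t₀).trans hmt₀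
  have main : ∀ g : ℝ → ℝ, (∀ t ∈ R, g t ≤ 2 * m t) →
      ∫⁻ t in Ioo (-l) l, ENNReal.ofReal (g t) ≤ ENNReal.ofReal (2 * N) * ν univ := by
    intro g hg
    calc ∫⁻ t in Ioo (-l) l, ENNReal.ofReal (g t)
        ≤ ∫⁻ t in Ioo (-l) l, ENNReal.ofReal 2 * ENNReal.ofReal (m t) := by
          refine lintegral_mono_ae ?_
          filter_upwards [hRae] with t ht
          rw [← ENNReal.ofReal_mul (by norm_num)]
          exact ENNReal.ofReal_le_ofReal (hg t ht)
      _ = ENNReal.ofReal 2 * ∫⁻ t in Ioo (-l) l, ENNReal.ofReal (m t) :=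
          lintegral_const_mul _ (by fun_prop)
      _ ≤ ENNReal.ofReal 2 * (ENNReal.ofReal N * ν univ) := by gcongr
      _ = _ := by rw [← mul_assoc, ← ENNReal.ofReal_mul (by norm_num)]
  have hcase : f t₀ ≤ 1 / 8 ∨ 7 / 8 ≤ f t₀ := by
    by_contra! h
    nlinarith
  rcases hcase with h | h
  · refine (min_le_left _ _).trans (main f fun t ht => ?_)
    have := abs_le.1 (hosc' t ht t₀ ht₀)
    nlinarith [hfm t, hf0 t]
  · refine (min_le_right _ _).trans (main (fun t => 1 - f t) fun t ht => ?_)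
    have := abs_le.1 (hosc' t ht t₀ ht₀)
    nlinarith [hfm t, hf1 t]

lemma min_setLIntegral_le_of_lt_one {α δ N l : ℝ} (hα0 : 0 < α) (hα1 : α < 1) (hδ0 : 0 < δ)
    (hδ : δ ≤ 1 / 4) (hN : 1 ≤ N) {f m : ℝ → ℝ}
    {ν : Measure ℝ} [IsFiniteMeasure ν] {R : Set ℝ} (hRm : MeasurableSet R)
    (hR : volume (Ioo (-l) l \ R) = 0) (hf : Measurable f)
    (hm : Measurable m) (hf0 : ∀ t, 0 ≤ f t) (hf1 : ∀ t, f t ≤ 1)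
    (hfm : ∀ t, f t * (1 - f t) ≤ m t)
    (hfα : ∀ t, f t ≤ δ → f t ^ α ≤ 2 * m t)
    (hfα' : ∀ t, 1 - f t ≤ δ → (1 - f t) ^ α ≤ 2 * m t)
    (hint : ∀ T, MeasurableSet T → T ⊆ Ioo (-l) l →
      ∫⁻ t in T, ENNReal.ofReal (m t) ≤ ENNReal.ofReal N * ν T)
    (hosc : ∀ s ∈ R, ∀ t ∈ R, s < t → |f s - f t| ≤ ν.real (Icc s t))
    (hlt : ν.real univ < 1) :
    min (∫⁻ t in Ioo (-l) l, ENNReal.ofReal (f t))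
      (∫⁻ t in Ioo (-l) l, ENNReal.ofReal (1 - f t)) ≤
        ENNReal.ofReal (2 * N / δ + 2 * N + (4 * N * growthConst α + 2)) := by
  set L := Ioo (-l) l with hL
  set W : ℝ := 2 * N * growthConst α with hW
  have hW0 : 0 ≤ W := mul_nonneg (by linarith) (growthConst_nonneg hα1)
  have hintL : ∫⁻ t in L, ENNReal.ofReal (m t) ≤ ENNReal.ofReal N := by
    refine (hint L measurableSet_Ioo subset_rfl).trans ?_
    calc ENNReal.ofReal N * ν L ≤ ENNReal.ofReal N * 1 := by
          gcongr
          refine (measure_mono (subset_univ _)).trans ?_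
          rw [← ofReal_measureReal (μ := ν) (s := univ), ← ENNReal.ofReal_one]
          exact ENNReal.ofReal_le_ofReal hlt.le
      _ = _ := mul_one _
  set X := L ∩ R ∩ {t | m t < δ / 2} with hX
  have hXm : MeasurableSet X := (measurableSet_Ioo.inter hRm).inter (measurableSet_lt hm measurable_const)
  set X₀ := X ∩ {t | f t ≤ δ} with hX₀
  set X₁ := X ∩ {t | 1 - f t ≤ δ} with hX₁
  have hX₀m : MeasurableSet X₀ := hXm.inter (measurableSet_le hf measurable_const)
  have hX₁m : MeasurableSet X₁ := hXm.inter (measurableSet_le (measurable_const.sub hf) measurable_const)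
  have hX₀L : X₀ ⊆ L := fun t ht => ht.1.1.1
  have hX₁L : X₁ ⊆ L := fun t ht => ht.1.1.1
  have hfinL : volume L ≠ ∞ := by simp [hL]
  have hunion : ∀ t ∈ X, t ∈ X₀ ∨ t ∈ X₁ := by
    intro t ht
    by_contra! hcon
    have h1 : δ < f t := by
      by_contra! h; exact hcon.1 ⟨ht, h⟩
    have h2 : δ < 1 - f t := by
      by_contra! h; exact hcon.2 ⟨ht, h⟩
    have h3 : m t < δ / 2 := ht.2
    nlinarith [hfm t, mul_pos (sub_pos.2 h1) (sub_pos.2 h2)]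
  have hbad : volume (L \ X) ≤ ENNReal.ofReal (2 * N / δ) := by
    have hsub : L \ X ⊆ (L \ R) ∪ (L ∩ {t | ENNReal.ofReal (δ / 2) ≤ ENNReal.ofReal (m t)}) := by
      intro t ht
      by_cases htR : t ∈ R
      · refine Or.inr ⟨ht.1, ENNReal.ofReal_le_ofReal ?_⟩
        by_contra! h
        exact ht.2 ⟨⟨ht.1, htR⟩, h⟩
      · exact Or.inl ⟨ht.1, htR⟩
    refine (measure_mono hsub).trans ((measure_union_le _ _).trans ?_)
    rw [hR, zero_add]
    have hmk := mul_meas_ge_le_lintegral₀ (μ := volume.restrict L)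
      (f := fun t => ENNReal.ofReal (m t)) (by fun_prop) (ENNReal.ofReal (δ / 2))
    rw [Measure.restrict_apply (measurableSet_le measurable_const (by fun_prop)), inter_comm] at hmk
    have h2 := hmk.trans hintL
    have hδ2 : 0 < δ / 2 := by positivity
    rw [mul_comm, ← ENNReal.le_div_iff_mul_le (Or.inl (by simpa using hδ2)) (Or.inl (by simp)),
      ← ENNReal.ofReal_div_of_pos hδ2] at h2
    refine h2.trans (ENNReal.ofReal_le_ofReal (le_of_eq ?_))
    field_simp
  by_contra! hcon
  obtain ⟨hc0, hc1⟩ := lt_min_iff.1 hcon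
  have hK0 : 0 ≤ 2 * N / δ := by positivity
  have conv : ∀ Z : Set ℝ, Z ⊆ L → ENNReal.ofReal (2 * N / δ + 2 * N + (4 * N * growthConst α + 2)) <
      ENNReal.ofReal (2 * N / δ) + volume Z + ENNReal.ofReal (2 * N) → 2 * W + 2 < volume.real Z := by
    intro Z hZ h
    have hZfin : volume Z ≠ ∞ := measure_ne_top_of_subset hZ hfinL
    rw [← ofReal_measureReal hZfin, ← ENNReal.ofReal_add hK0 measureReal_nonneg,
      ← ENNReal.ofReal_add (add_nonneg hK0 measureReal_nonneg) (by linarith)] at h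
    have := (ENNReal.ofReal_lt_ofReal_iff_of_nonneg (by linarith)).1 h
    rw [hW]
    linarith
  have hv1 : 2 * W + 2 < volume.real X₁ := by
    refine conv X₁ hX₁L (hc0.trans_le ?_)
    refine setLIntegral_ofReal_le measurableSet_Ioo hXm hX₁m hm hf1 (fun t ht ht1 => ?_)
      hbad hintL
    have h0 : f t ≤ δ := ((hunion t ht).resolve_right ht1).2
    nlinarith [hfm t, hf0 t]
  have hv0 : 2 * W + 2 < volume.real X₀ := by
    refine conv X₀ hX₀L (hc1.trans_le ?_)
    refine setLIntegral_ofReal_le (f := fun t => 1 - f t) measurableSet_Ioo hXm hX₀m hm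
      (fun t => by linarith [hf0 t]) (fun t ht ht1 => ?_) hbad hintL
    have h0 : 1 - f t ≤ δ := ((hunion t ht).resolve_left ht1).2
    nlinarith [hfm t, hf1 t]
  obtain ⟨p, hp1, hp2⟩ := exists_median hX₀m hX₀L
  have toVol : ∀ Z : Set ℝ, W < volume.real Z → ENNReal.ofReal W < volume Z := by
    intro Z hZ
    exact (ENNReal.ofReal_lt_iff_lt_toReal hW0 (fun h => by
      rw [measureReal_def, h] at hZ; simp at hZ; linarith)).2 hZ
  have hsplit : volume.real X₁ ≤ volume.real (X₁ ∩ Iio p) + volume.real (X₁ ∩ Ioi p) := by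
    have hae : volume.real (X₁ ∩ Ioi p) = volume.real (X₁ \ Iio p) := by
      rw [sdiff_eq, compl_Iio]
      exact measureReal_congr ((ae_eq_refl X₁).inter Ioi_ae_eq_Ici)
    rw [hae, measureReal_inter_add_sdiff (measurableSet_Iio (a := p))
      (measure_ne_top_of_subset hX₁L hfinL)]
  refine absurd ?_ (not_le.2 hlt)
  rcases le_or_gt (volume.real (X₁ ∩ Ioi p)) W with hr | hr
  · refine one_le_measureReal_of_crossing (f := fun t => 1 - f t) (p := p) (X := X₁ ∩ Iio p)
      (Y := X₀ ∩ Ioi p) hα0 hα1 (by linarith : (0 : ℝ) ≤ N)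
      hm (hX₁m.inter measurableSet_Iio) (hX₀m.inter measurableSet_Ioi) inter_subset_right
      inter_subset_right (fun t ht => hfα' t ht.1.2) (fun t ht => ?_) (fun T hT hTX => hint T hT ?_)
      (fun s hs t ht => ?_) (toVol _ (by linarith)) (toVol _ (by linarith))
    · rw [sub_sub_cancel]; exact hfα t ht.1.2
    · exact hTX.trans (union_subset (inter_subset_left.trans hX₁L) (inter_subset_left.trans hX₀L))
    · have := hosc s hs.1.1.1.2 t ht.1.1.1.2 (lt_trans hs.2 ht.2)
      rw [abs_sub_comm] at this
      simpa using this
  · refine one_le_measureReal_of_crossing (f := f) (p := p) (X := X₀ ∩ Iio p)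
      (Y := X₁ ∩ Ioi p) hα0 hα1 (by linarith : (0 : ℝ) ≤ N)
      hm (hX₀m.inter measurableSet_Iio) (hX₁m.inter measurableSet_Ioi) inter_subset_right
      inter_subset_right (fun t ht => hfα t ht.1.2) (fun t ht => hfα' t ht.1.2)
      (fun T hT hTX => hint T hT ?_)
      (fun s hs t ht => ?_) (toVol _ (by linarith)) (toVol _ hr)
    · exact hTX.trans (union_subset (inter_subset_left.trans hX₀L) (inter_subset_left.trans hX₁L))
    · exact hosc s hs.1.1.1.2 t ht.1.1.1.2 (lt_trans hs.2 ht.2)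

/-- The one-dimensional dichotomy behind the isoperimetric inequality: a density `f` whose
oscillation and transversal cost are controlled by a measure of mass less than one is close to `0`
or close to `1` in the mean. -/
theorem exists_min_setLIntegral_le {α δ N : ℝ} (hα0 : 0 < α) (hα1 : α < 1) (hδ0 : 0 < δ)
    (hδ : δ ≤ 1 / 4) (hN : 1 ≤ N) : ∃ C : ℝ, 1 ≤ C ∧ ∀ (l : ℝ), 1 ≤ l → ∀ (f m : ℝ → ℝ)
    (ν : Measure ℝ) [IsFiniteMeasure ν] (R : Set ℝ), MeasurableSet R →
    volume (Ioo (-l) l \ R) = 0 → Measurable f → Measurable m →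
    (∀ t, 0 ≤ f t) → (∀ t, f t ≤ 1) → (∀ t, f t * (1 - f t) ≤ m t) →
    (∀ t, f t ≤ δ → f t ^ α ≤ 2 * m t) → (∀ t, 1 - f t ≤ δ → (1 - f t) ^ α ≤ 2 * m t) →
    (∀ T, MeasurableSet T → T ⊆ Ioo (-l) l →
      ∫⁻ t in T, ENNReal.ofReal (m t) ≤ ENNReal.ofReal N * ν T) →
    (∀ s ∈ R, ∀ t ∈ R, s < t → |f s - f t| ≤ ν.real (Icc s t)) → ν.real univ < 1 →
    min (∫⁻ t in Ioo (-l) l, ENNReal.ofReal (f t))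
      (∫⁻ t in Ioo (-l) l, ENNReal.ofReal (1 - f t)) ≤ ENNReal.ofReal C * ν univ := by
  set K : ℝ := 2 * N / δ + 2 * N + (4 * N * growthConst α + 2) with hK
  have hK0 : 0 ≤ K := by
    have := growthConst_nonneg hα1
    positivity
  refine ⟨2 * N + 16 * N * K, by nlinarith, ?_⟩
  intro l hl f m ν _ R hRm hR hf hm hf0 hf1 hfm hfα hfα' hint hosc hlt
  rcases le_or_gt (ν.real univ) (1 / (16 * N)) with h | h
  · refine (min_setLIntegral_le_of_small hN hl hR hm hf0 hf1 hfm
      ((hint _ measurableSet_Ioo subset_rfl).trans (by gcongr; exact subset_univ _))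
      (fun s hs t ht hst => (hosc s hs t ht hst).trans (measureReal_mono (subset_univ _))) h).trans ?_
    gcongr
    have : 0 ≤ 16 * N * K := by positivity
    linarith
  · refine (min_setLIntegral_le_of_lt_one hα0 hα1 hδ0 hδ hN hRm hR hf hm hf0 hf1 hfm hfα hfα' hint
      hosc hlt).trans ?_
    rw [← ofReal_measureReal (μ := ν) (s := univ), ← ENNReal.ofReal_mul (by positivity)]
    refine ENNReal.ofReal_le_ofReal ?_
    rw [div_lt_iff₀ (by positivity)] at h
    have h1 : 0 ≤ ν.real univ := measureReal_nonneg
    nlinarith [mul_nonneg (show 0 ≤ 2 * N by positivity) h1]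

end LongCuboid

namespace LongCuboid

open Function

section Slices

variable {n : ℕ}

/-- The point of `ℝ ^ (n + 1)` with `j`-th coordinate `q.1` and remaining coordinates `q.2`. -/
def lineMap (j : Fin (n + 1)) (q : ℝ × (Fin n → ℝ)) : Fin (n + 1) → ℝ :=
  j.insertNth (α := fun _ => ℝ) q.1 q.2

@[simp] lemma lineMap_apply_same (j : Fin (n + 1)) (q : ℝ × (Fin n → ℝ)) :
    lineMap j q j = q.1 := by simp [lineMap]

@[simp] lemma lineMap_apply_succAbove (j : Fin (n + 1)) (q : ℝ × (Fin n → ℝ)) (k : Fin n) :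
    lineMap j q (j.succAbove k) = q.2 k := by simp [lineMap]

lemma lineMap_removeNth_update (j : Fin (n + 1)) (x : Fin (n + 1) → ℝ) (s : ℝ) :
    lineMap j (s, j.removeNth x) = update x j s := by simp [lineMap]

lemma removeNth_lineMap (j : Fin (n + 1)) (q : ℝ × (Fin n → ℝ)) :
    j.removeNth (lineMap j q) = q.2 := by simp [lineMap]

lemma lineMap_zero_update (t : ℝ) (y : Fin n → ℝ) (i : Fin n) (s : ℝ) :
    lineMap 0 (t, update y i s) = update (lineMap 0 (t, y)) i.succ s := by
  simp [lineMap]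

lemma measurable_lineMap (j : Fin (n + 1)) : Measurable (lineMap j) :=
  (MeasurableEquiv.piFinSuccAbove (fun _ : Fin (n + 1) => ℝ) j).symm.measurable

lemma volume_preserving_lineMap (j : Fin (n + 1)) :
    MeasurePreserving (lineMap j) volume volume :=
  (volume_preserving_piFinSuccAbove (fun _ : Fin (n + 1) => ℝ) j).symm

/-- The points with first coordinate in `T` and all other coordinates in `(-1/2, 1/2)`. -/
def box (n : ℕ) (T : Set ℝ) : Set (Fin (n + 1) → ℝ) :=
  {x | ∀ p, x p ∈ if p = 0 then T else Ioo (-(1 / 2)) (1 / 2)}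

/-- The projection of `box n T` in direction `j`. -/
def boxSection (j : Fin (n + 1)) (T : Set ℝ) : Set (Fin n → ℝ) :=
  {z | ∀ k, z k ∈ if j.succAbove k = 0 then T else Ioo (-(1 / 2)) (1 / 2)}

lemma measurableSet_boxSection (j : Fin (n + 1)) {T : Set ℝ} (hT : MeasurableSet T) :
    MeasurableSet (boxSection j T) := by
  have : boxSection j T = univ.pi fun k => if j.succAbove k = 0 then T else Ioo (-(1 / 2)) (1 / 2) := by
    ext z; simp [boxSection]
  rw [this]
  refine MeasurableSet.univ_pi fun k => ?_
  split_ifs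
  exacts [hT, measurableSet_Ioo]

lemma measurableSet_box {T : Set ℝ} (hT : MeasurableSet T) : MeasurableSet (box n T) := by
  have : box n T = univ.pi fun k => if k = 0 then T else Ioo (-(1 / 2)) (1 / 2) := by
    ext z; simp [box]
  rw [this]
  refine MeasurableSet.univ_pi fun k => ?_
  split_ifs
  exacts [hT, measurableSet_Ioo]

lemma mem_box_iff (j : Fin (n + 1)) {T : Set ℝ} {x : Fin (n + 1) → ℝ} :
    x ∈ box n T ↔ (x j ∈ if j = 0 then T else Ioo (-(1 / 2)) (1 / 2)) ∧
      j.removeNth x ∈ boxSection j T :=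
  Fin.forall_iff_succAbove j

lemma lineMap_mem_box_iff (j : Fin (n + 1)) {T : Set ℝ} {q : ℝ × (Fin n → ℝ)} :
    lineMap j q ∈ box n T ↔ (q.1 ∈ if j = 0 then T else Ioo (-(1 / 2)) (1 / 2)) ∧
      q.2 ∈ boxSection j T := by
  rw [mem_box_iff j, lineMap_apply_same, removeNth_lineMap]

/-- The lines in direction `j`, given by their base points, which meet both `E` and its complement
in sets of positive measure for parameters in `(a, b)`. -/
def mixedSegments (E : Set (Fin (n + 1) → ℝ)) (j : Fin (n + 1)) (a b : ℝ) : Set (Fin n → ℝ) :=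
  {z | volume {s | s ∈ Ioo a b ∧ lineMap j (s, z) ∈ E} ≠ 0 ∧
    volume {s | s ∈ Ioo a b ∧ lineMap j (s, z) ∉ E} ≠ 0}

/-- Lebesgue measure on the unit interval centred at the origin. -/
noncomputable def unitMeasure : Measure ℝ := volume.restrict (Ioo (-(1 / 2)) (1 / 2))

instance : IsProbabilityMeasure unitMeasure :=
  ⟨by rw [unitMeasure, Measure.restrict_apply_univ, Real.volume_Ioo]; norm_num⟩

lemma pi_unitMeasure (T : Set ℝ) :
    (Measure.pi fun _ : Fin n => unitMeasure) = volume.restrict (boxSection 0 T) := by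
  have : boxSection (0 : Fin (n + 1)) T = univ.pi fun _ => Ioo (-(1 / 2)) (1 / 2) := by
    ext z; simp [boxSection]
  rw [this, volume_pi, Measure.restrict_pi_pi]
  rfl

/-- The slice of `E` at first coordinate `t`. -/
def slice (E : Set (Fin (n + 1) → ℝ)) (t : ℝ) : Set (Fin n → ℝ) := {y | lineMap 0 (t, y) ∈ E}

lemma measurableSet_slice {E : Set (Fin (n + 1) → ℝ)} (hE : MeasurableSet E) (t : ℝ) :
    MeasurableSet (slice E t) :=
  ((measurable_lineMap 0).comp measurable_prodMk_left) hE

lemma measurable_measure_slice {E : Set (Fin (n + 1) → ℝ)} (hE : MeasurableSet E) :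
    Measurable fun t => (Measure.pi fun _ : Fin n => unitMeasure) (slice E t) :=
  measurable_measure_prodMk_left (measurable_lineMap 0 hE)

lemma setLIntegral_measure_slice {E : Set (Fin (n + 1) → ℝ)} (hE : MeasurableSet E) {T : Set ℝ}
    (hT : MeasurableSet T) :
    ∫⁻ t in T, (Measure.pi fun _ : Fin n => unitMeasure) (slice E t) = volume (E ∩ box n T) := by
  rw [pi_unitMeasure T]
  have hEm : MeasurableSet (lineMap (0 : Fin (n + 1)) ⁻¹' E) := measurable_lineMap 0 hE
  rw [← (volume_preserving_lineMap 0).measure_preimage (hE.inter (measurableSet_box hT)).nullMeasurableSet]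
  have h := Measure.prod_apply (μ := volume.restrict T)
    (ν := volume.restrict (boxSection (0 : Fin (n + 1)) T)) hEm
  rw [Measure.prod_restrict, ← Measure.volume_eq_prod, Measure.restrict_apply hEm] at h
  refine h.symm.trans ?_
  congr 1
  ext q
  simp only [preimage_inter, mem_inter_iff, mem_preimage, lineMap_mem_box_iff, if_true, mem_prod]

lemma mem_mixedLines_slice_iff {E : Set (Fin (n + 1) → ℝ)} (hE : MeasurableSet E) (t : ℝ)
    (y : Fin n → ℝ) (i : Fin n) : y ∈ mixedLines unitMeasure (slice E t) i ↔
      i.succ.removeNth (lineMap 0 (t, y)) ∈ mixedSegments E i.succ (-(1 / 2)) (1 / 2) := by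
  have key : ∀ A : Set (Fin (n + 1) → ℝ), MeasurableSet A →
      lineFraction unitMeasure (slice A t) i y =
      volume {s | s ∈ Ioo (-(1 / 2)) (1 / 2) ∧
        lineMap i.succ (s, i.succ.removeNth (lineMap 0 (t, y))) ∈ A} := by
    intro A hA
    have hm : MeasurableSet {s | update y i s ∈ slice A t} :=
      measurable_update y (measurableSet_slice hA t)
    rw [lineFraction, unitMeasure, Measure.restrict_apply hm]
    congr 1
    ext s
    simp only [slice, mem_inter_iff, mem_ofPred_eq, lineMap_zero_update, lineMap_removeNth_update]
    exact and_comm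
  have h1 := key E hE
  have h2 := key Eᶜ hE.compl
  simp only [mixedLines, mixedSegments, mem_ofPred_eq]
  rw [h1]
  exact and_congr Iff.rfl (not_congr (Eq.congr_left h2))

lemma measurable_volume_segment {E : Set (Fin (n + 1) → ℝ)} (hE : MeasurableSet E)
    (j : Fin (n + 1)) (a b : ℝ) :
    Measurable fun z => volume {s | s ∈ Ioo a b ∧ lineMap j (s, z) ∈ E} := by
  have hm : MeasurableSet {q : (Fin n → ℝ) × ℝ | q.2 ∈ Ioo a b ∧ lineMap j q.swap ∈ E} :=
    (measurable_snd measurableSet_Ioo).inter ((measurable_lineMap j).comp measurable_swap hE)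
  exact measurable_measure_prodMk_left hm

lemma measurableSet_mixedSegments {E : Set (Fin (n + 1) → ℝ)} (hE : MeasurableSet E)
    (j : Fin (n + 1)) (a b : ℝ) : MeasurableSet (mixedSegments E j a b) := by
  exact (measurable_volume_segment hE j a b (measurableSet_singleton 0).compl).inter
    (measurable_volume_segment hE.compl j a b (measurableSet_singleton 0).compl)

/-- The mixed segments of `E` in `box n (-l, l)` are controlled by the measure `ν`. -/
def ControlsMixedSegments (ν : Measure (Fin (n + 1) → ℝ)) (E : Set (Fin (n + 1) → ℝ)) (l : ℝ) :
    Prop :=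
  ∀ (j : Fin (n + 1)) (a b : ℝ) (Z : Set (Fin n → ℝ)), MeasurableSet Z →
    (∀ s ∈ Ioo a b, ∀ z ∈ Z, lineMap j (s, z) ∈ box n (Ioo (-l) l)) →
    volume (Z ∩ mixedSegments E j a b) ≤ ν {x | x j ∈ Ioo a b ∧ j.removeNth x ∈ Z}

lemma measurable_removeNth (j : Fin (n + 1)) :
    Measurable fun x : Fin (n + 1) → ℝ => j.removeNth x :=
  measurable_pi_lambda _ fun _ => measurable_pi_apply _

lemma slice_preimage_mixedSegments {E : Set (Fin (n + 1) → ℝ)} (hE : MeasurableSet E) (i : Fin n)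
    (t : ℝ) : slice ((fun x => i.succ.removeNth x) ⁻¹' mixedSegments E i.succ (-(1 / 2)) (1 / 2)) t =
      mixedLines unitMeasure (slice E t) i := by
  ext y
  rw [mem_mixedLines_slice_iff hE]
  rfl

lemma measurable_measure_mixedLines_slice {E : Set (Fin (n + 1) → ℝ)} (hE : MeasurableSet E)
    (i : Fin n) : Measurable fun t =>
      (Measure.pi fun _ : Fin n => unitMeasure) (mixedLines unitMeasure (slice E t) i) := by
  simp_rw [← slice_preimage_mixedSegments hE]
  exact measurable_measure_slice (measurable_removeNth _ (measurableSet_mixedSegments hE _ _ _))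

lemma setLIntegral_mixedLines_slice_le {ν : Measure (Fin (n + 1) → ℝ)}
    {E : Set (Fin (n + 1) → ℝ)} (hE : MeasurableSet E) {l : ℝ} (hν : ControlsMixedSegments ν E l)
    {T : Set ℝ} (hT : MeasurableSet T) (hTl : T ⊆ Ioo (-l) l) (i : Fin n) :
    ∫⁻ t in T, (Measure.pi fun _ : Fin n => unitMeasure) (mixedLines unitMeasure (slice E t) i) ≤
      (ν.map fun x => x 0) T := by
  have hMm : MeasurableSet ((fun x : Fin (n + 1) → ℝ => i.succ.removeNth x) ⁻¹'
      mixedSegments E i.succ (-(1 / 2)) (1 / 2)) :=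
    measurable_removeNth _ (measurableSet_mixedSegments hE _ _ _)
  simp_rw [← slice_preimage_mixedSegments hE]
  rw [setLIntegral_measure_slice hMm hT,
    ← (volume_preserving_lineMap i.succ).measure_preimage
      (hMm.inter (measurableSet_box hT)).nullMeasurableSet]
  have hpre : lineMap i.succ ⁻¹' (((fun x : Fin (n + 1) → ℝ => i.succ.removeNth x) ⁻¹'
      mixedSegments E i.succ (-(1 / 2)) (1 / 2)) ∩ box n T) =
      Ioo (-(1 / 2)) (1 / 2) ×ˢ (boxSection i.succ T ∩
        mixedSegments E i.succ (-(1 / 2)) (1 / 2)) := by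
    ext q
    simp only [preimage_inter, mem_inter_iff, mem_preimage, removeNth_lineMap, lineMap_mem_box_iff,
      mem_prod, if_neg (Fin.succ_ne_zero i)]
    tauto
  rw [hpre, Measure.volume_eq_prod, Measure.prod_prod, Real.volume_Ioo]
  have hbox : ∀ s ∈ Ioo (-(1 / 2) : ℝ) (1 / 2), ∀ z ∈ boxSection i.succ T,
      lineMap i.succ (s, z) ∈ box n T := by
    intro s hs z hz
    rw [lineMap_mem_box_iff, if_neg (Fin.succ_ne_zero i)]
    exact ⟨hs, hz⟩
  have hsub : box n T ⊆ box n (Ioo (-l) l) := by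
    intro x hx p
    have := hx p
    split_ifs at this ⊢
    exacts [hTl this, this]
  have h := hν i.succ (-(1 / 2)) (1 / 2) _ (measurableSet_boxSection i.succ hT)
    (fun s hs z hz => hsub (hbox s hs z hz))
  norm_num at h ⊢
  refine h.trans ?_
  rw [Measure.map_apply (measurable_pi_apply 0) hT]
  refine measure_mono fun x hx => ?_
  have hx' : x ∈ box n T := (mem_box_iff i.succ).2 ⟨by
    rw [if_neg (Fin.succ_ne_zero i)]; norm_num; exact hx.1, hx.2⟩
  simpa using hx' 0

lemma exists_ae_measure_slice_mem_Icc {ν : Measure (Fin (n + 1) → ℝ)}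
    {E : Set (Fin (n + 1) → ℝ)} (hE : MeasurableSet E) {l : ℝ} (hν : ControlsMixedSegments ν E l)
    {a b : ℝ} (hab : Ioo a b ⊆ Ioo (-l) l) :
    ∃ g : ℝ≥0∞, ∀ᵐ t, t ∈ Ioo a b →
      g ≤ (Measure.pi fun _ : Fin n => unitMeasure) (slice E t) ∧
      (Measure.pi fun _ : Fin n => unitMeasure) (slice E t) ≤ g + (ν.map fun x => x 0) (Ioo a b) := by
  set π := Measure.pi fun _ : Fin n => unitMeasure with hπ
  set G : Set (Fin n → ℝ) := {z | volume {s | s ∈ Ioo a b ∧ lineMap 0 (s, z) ∉ E} = 0} with hG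
  set G' : Set (Fin n → ℝ) := {z | volume {s | s ∈ Ioo a b ∧ lineMap 0 (s, z) ∈ E} = 0} with hG'
  have hGm : MeasurableSet G := measurable_volume_segment hE.compl 0 a b (measurableSet_singleton 0)
  have hGm' : MeasurableSet G' := measurable_volume_segment hE 0 a b (measurableSet_singleton 0)
  have hae : ∀ᵐ t : ℝ, ∀ᵐ y ∂π, t ∈ Ioo a b →
      ((y ∈ G → y ∈ slice E t) ∧ (y ∈ G' → y ∉ slice E t)) := by
    have hEm : MeasurableSet {q : ℝ × (Fin n → ℝ) | q.2 ∈ slice E q.1} := measurable_lineMap 0 hE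
    have hm : MeasurableSet {q : ℝ × (Fin n → ℝ) | q.1 ∈ Ioo a b →
        ((q.2 ∈ G → q.2 ∈ slice E q.1) ∧ (q.2 ∈ G' → q.2 ∉ slice E q.1))} :=
      (measurable_fst measurableSet_Ioo).imp
        (((measurable_snd hGm).imp hEm).inter ((measurable_snd hGm').imp hEm.compl))
    rw [Measure.ae_ae_comm hm]
    refine Eventually.of_forall fun y => ?_
    have h1 : ∀ᵐ t : ℝ, y ∈ G → ¬ (t ∈ Ioo a b ∧ lineMap 0 (t, y) ∉ E) := by
      by_cases hy : y ∈ G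
      · have : ∀ᵐ t : ℝ, ¬ (t ∈ Ioo a b ∧ lineMap 0 (t, y) ∉ E) := by
          rw [ae_iff]; simp only [not_not]; exact hy
        filter_upwards [this] with t ht _ using ht
      · exact Eventually.of_forall fun t h => absurd h hy
    have h2 : ∀ᵐ t : ℝ, y ∈ G' → ¬ (t ∈ Ioo a b ∧ lineMap 0 (t, y) ∈ E) := by
      by_cases hy : y ∈ G'
      · have : ∀ᵐ t : ℝ, ¬ (t ∈ Ioo a b ∧ lineMap 0 (t, y) ∈ E) := by
          rw [ae_iff]; simp only [not_not]; exact hy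
        filter_upwards [this] with t ht _ using ht
      · exact Eventually.of_forall fun t h => absurd h hy
    filter_upwards [h1, h2] with t h1 h2 ht
    refine ⟨fun hy => ?_, fun hy hyE => h2 hy ⟨ht, hyE⟩⟩
    by_contra hyE
    exact h1 hy ⟨ht, hyE⟩
  have hmix : π (mixedSegments E 0 a b) ≤ (ν.map fun x => x 0) (Ioo a b) := by
    have h := hν 0 a b (boxSection 0 (Ioo (-l) l)) (measurableSet_boxSection 0 measurableSet_Ioo)
      (fun s hs z hz => (lineMap_mem_box_iff 0).2 ⟨by simpa using hab hs, hz⟩)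
    rw [hπ, pi_unitMeasure (Ioo (-l) l),
      Measure.restrict_apply (measurableSet_mixedSegments hE _ _ _), inter_comm]
    refine h.trans ?_
    rw [Measure.map_apply (measurable_pi_apply 0) measurableSet_Ioo]
    exact measure_mono fun x hx => hx.1
  refine ⟨π G, ?_⟩
  filter_upwards [hae] with t ht htab
  constructor
  · refine measure_mono_ae ?_
    filter_upwards [ht] with y hy hyG
    exact (hy htab).1 hyG
  · calc π (slice E t) ≤ π (G ∪ mixedSegments E 0 a b) := by
          refine measure_mono_ae ?_
          filter_upwards [ht] with y hy hyE
          by_cases hyG : y ∈ G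
          · exact Or.inl hyG
          · exact Or.inr ⟨fun h => (hy htab).2 h hyE, hyG⟩
      _ ≤ π G + π (mixedSegments E 0 a b) := measure_union_le _ _
      _ ≤ _ := by gcongr

lemma exists_measurableSet_abs_sub_le {ν : Measure (Fin (n + 1) → ℝ)} [IsFiniteMeasure ν]
    {E : Set (Fin (n + 1) → ℝ)} (hE : MeasurableSet E) {l : ℝ} (hν : ControlsMixedSegments ν E l) :
    ∃ R, MeasurableSet R ∧ volume (Ioo (-l) l \ R) = 0 ∧ ∀ s ∈ R, ∀ t ∈ R, s < t →
      |((Measure.pi fun _ : Fin n => unitMeasure) (slice E s)).toReal -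
        ((Measure.pi fun _ : Fin n => unitMeasure) (slice E t)).toReal| ≤
          (ν.map fun x => x 0).real (Icc s t) := by
  set π := Measure.pi fun _ : Fin n => unitMeasure with hπ
  set ν₀ := ν.map fun x => x 0 with hν₀
  have : IsFiniteMeasure ν₀ := by rw [hν₀]; infer_instance
  have h1 : ∀ q : ℚ × ℚ, ∃ g : ℝ≥0∞, ∀ᵐ t, Ioo (q.1 : ℝ) q.2 ⊆ Ioo (-l) l →
      t ∈ Ioo (q.1 : ℝ) q.2 →
      g ≤ π (slice E t) ∧ π (slice E t) ≤ g + ν₀ (Ioo (q.1 : ℝ) q.2) := by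
    intro q
    by_cases hq : Ioo (q.1 : ℝ) q.2 ⊆ Ioo (-l) l
    · obtain ⟨g, hg⟩ := exists_ae_measure_slice_mem_Icc hE hν hq
      exact ⟨g, by filter_upwards [hg] with t ht _ using ht⟩
    · exact ⟨0, Eventually.of_forall fun t h => absurd h hq⟩
  choose g hg using h1
  have hall := ae_all_iff.2 hg
  set B := {t | ¬ ∀ q : ℚ × ℚ, Ioo (q.1 : ℝ) q.2 ⊆ Ioo (-l) l → t ∈ Ioo (q.1 : ℝ) q.2 →
      g q ≤ π (slice E t) ∧ π (slice E t) ≤ g q + ν₀ (Ioo (q.1 : ℝ) q.2)} with hB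
  have hB0 : volume B = 0 := hall
  refine ⟨Ioo (-l) l ∩ (toMeasurable volume B)ᶜ,
    measurableSet_Ioo.inter (measurableSet_toMeasurable _ _).compl, ?_, ?_⟩
  · refine measure_mono_null (t := toMeasurable volume B) (fun t ht => ?_)
      (by rw [measure_toMeasurable, hB0])
    by_contra h
    exact ht.2 ⟨ht.1, h⟩
  intro s hs t ht hst
  have hs' : s ∉ B := fun h => hs.2 (subset_toMeasurable _ _ h)
  have ht' : t ∉ B := fun h => ht.2 (subset_toMeasurable _ _ h)
  simp only [hB, mem_ofPred_eq, not_not] at hs' ht'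
  by_contra! hcon
  have hlt : ν₀ (Icc s t) < ENNReal.ofReal |(π (slice E s)).toReal - (π (slice E t)).toReal| := by
    rw [← ofReal_measureReal (μ := ν₀) (s := Icc s t)]
    exact (ENNReal.ofReal_lt_ofReal_iff_of_nonneg measureReal_nonneg).2 hcon
  obtain ⟨U, hU, hUo, hUlt⟩ := Set.exists_isOpen_lt_of_lt _ _ hlt
  have hVo : IsOpen (U ∩ Ioo (-l) l) := hUo.inter isOpen_Ioo
  obtain ⟨a', ha', hsa⟩ := exists_Ioc_subset_of_mem_nhds
    (hVo.mem_nhds ⟨hU ⟨le_rfl, hst.le⟩, hs.1⟩) ⟨s - 1, by linarith⟩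
  obtain ⟨b', hb', htb⟩ := exists_Ico_subset_of_mem_nhds
    (hVo.mem_nhds ⟨hU ⟨hst.le, le_rfl⟩, ht.1⟩) ⟨t + 1, by linarith⟩
  obtain ⟨a, ha1, ha2⟩ := exists_rat_btwn ha'
  obtain ⟨b, hb1, hb2⟩ := exists_rat_btwn hb'
  have hsub : Ioo (a : ℝ) b ⊆ U ∩ Ioo (-l) l := by
    intro x hx
    rcases le_or_gt x s with h | h
    · exact hsa ⟨ha1.trans hx.1, h⟩
    · rcases le_or_gt t x with h' | h'
      · exact htb ⟨h', hx.2.trans hb2⟩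
      · exact ⟨hU ⟨h.le, h'.le⟩, hs.1.1.trans h, h'.trans ht.1.2⟩
  have es := hs' (a, b) (hsub.trans inter_subset_right) ⟨ha2, hst.trans hb1⟩
  have et := ht' (a, b) (hsub.trans inter_subset_right) ⟨ha2.trans hst, hb1⟩
  simp only at es et
  have hνU : ν₀.real (Ioo (a : ℝ) b) < |(π (slice E s)).toReal - (π (slice E t)).toReal| := by
    have : ν₀ (Ioo (a : ℝ) b) <
        ENNReal.ofReal |(π (slice E s)).toReal - (π (slice E t)).toReal| :=
      (measure_mono (hsub.trans inter_subset_left)).trans_lt hUlt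
    rwa [← ofReal_measureReal (μ := ν₀) (s := Ioo (a : ℝ) b),
      ENNReal.ofReal_lt_ofReal_iff_of_nonneg measureReal_nonneg] at this
  have hgfin : g (a, b) ≠ ∞ := ne_top_of_le_ne_top (measure_ne_top π _) es.1
  have es1 := ENNReal.toReal_mono (measure_ne_top π _) es.1
  have et1 := ENNReal.toReal_mono (measure_ne_top π _) et.1
  have hfin : g (a, b) + ν₀ (Ioo (a : ℝ) b) ≠ ∞ := ENNReal.add_ne_top.2 ⟨hgfin, measure_ne_top _ _⟩
  have es2 := ENNReal.toReal_mono hfin es.2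
  have et2 := ENNReal.toReal_mono hfin et.2
  rw [ENNReal.toReal_add hgfin (measure_ne_top _ _)] at es2 et2
  rw [measureReal_def] at hνU
  refine absurd hνU (not_lt.2 (abs_le.2 ⟨by linarith, by linarith⟩))

/-- An isoperimetric inequality in long boxes of unit cross-section, for sets whose mixed segments
are controlled by a measure of total mass less than one. -/
theorem exists_min_volume_box_le (n : ℕ) : ∃ C : ℝ, 1 ≤ C ∧ ∀ l : ℝ, 1 ≤ l →
    ∀ E : Set (Fin (n + 1) → ℝ), MeasurableSet E → ∀ ν : Measure (Fin (n + 1) → ℝ),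
    ControlsMixedSegments ν E l → ν univ < 1 →
    min (volume (E ∩ box n (Ioo (-l) l))) (volume (box n (Ioo (-l) l) \ E)) ≤
      ENNReal.ofReal C * ν univ := by
  set π := Measure.pi fun _ : Fin n => unitMeasure with hπ
  have hfin : ∀ (E : Set (Fin (n + 1) → ℝ)) t, ENNReal.ofReal (π (slice E t)).toReal = π (slice E t) :=
    fun E t => ENNReal.ofReal_toReal (measure_ne_top _ _)
  have hcompl : ∀ E : Set (Fin (n + 1) → ℝ), MeasurableSet E → ∀ t,
      1 - (π (slice E t)).toReal = (π (slice E t)ᶜ).toReal := by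
    intro E hE t
    have := probReal_compl_eq_one_sub (μ := π) (measurableSet_slice hE t)
    rw [measureReal_def, measureReal_def] at this
    exact this.symm
  have hI : ∀ (E : Set (Fin (n + 1) → ℝ)), MeasurableSet E → ∀ l : ℝ,
      ∫⁻ t in Ioo (-l) l, ENNReal.ofReal (π (slice E t)).toReal =
        volume (E ∩ box n (Ioo (-l) l)) := by
    intro E hE l
    simp_rw [hfin]
    exact setLIntegral_measure_slice hE measurableSet_Ioo
  have hI' : ∀ (E : Set (Fin (n + 1) → ℝ)), MeasurableSet E → ∀ l : ℝ,
      ∫⁻ t in Ioo (-l) l, ENNReal.ofReal (1 - (π (slice E t)).toReal) =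
        volume (box n (Ioo (-l) l) \ E) := by
    intro E hE l
    simp_rw [hcompl E hE]
    refine (hI Eᶜ hE.compl l).trans ?_
    rw [inter_comm, sdiff_eq]
  have hmap : ∀ ν : Measure (Fin (n + 1) → ℝ), (ν.map fun x => x 0) univ = ν univ := fun ν => by
    rw [Measure.map_apply (measurable_pi_apply 0) MeasurableSet.univ, preimage_univ]
  have hmapreal : ∀ ν : Measure (Fin (n + 1) → ℝ), ν univ < 1 →
      (ν.map fun x => x 0).real univ < 1 := by
    intro ν hν
    rw [measureReal_def, hmap, ← ENNReal.toReal_one]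
    exact (ENNReal.toReal_lt_toReal hν.ne_top (by simp)).2 hν
  rcases Nat.eq_zero_or_pos n with rfl | hn
  · refine ⟨1, le_rfl, fun l hl E hE ν hν hν1 => ?_⟩
    have : IsFiniteMeasure ν := ⟨hν1.trans (by simp)⟩
    obtain ⟨R, hRm, hR0, hosc⟩ := exists_measurableSet_abs_sub_le hE hν
    refine le_trans (le_of_eq ?_) zero_le
    have h01 : ∀ t, (π (slice E t)).toReal = 0 ∨ (π (slice E t)).toReal = 1 := by
      intro t
      rcases (slice E t).eq_empty_or_nonempty with h | h
      · left; simp [h]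
      · right; rw [Subsingleton.eq_univ_of_nonempty h]; simp
    have hRae : ∀ᵐ t ∂volume.restrict (Ioo (-l) l), t ∈ R := by
      rw [ae_restrict_iff' measurableSet_Ioo]
      refine measure_mono_null (fun t ht => ?_) hR0
      simp only [mem_compl_iff, mem_ofPred_eq, Classical.not_imp] at ht
      exact ht
    have hconst : ∀ s ∈ R, ∀ t ∈ R, s < t →
        |(π (slice E s)).toReal - (π (slice E t)).toReal| < 1 := fun s hs t ht hst =>
      (hosc s hs t ht hst).trans_lt ((measureReal_mono (subset_univ _)).trans_lt (hmapreal ν hν1))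
    have hcase : (∀ t ∈ R, (π (slice E t)).toReal = 0) ∨ (∀ t ∈ R, (π (slice E t)).toReal = 1) := by
      by_contra! h
      obtain ⟨⟨s, hs, hs0⟩, ⟨t, ht, ht1⟩⟩ := h
      have es := (h01 s).resolve_left hs0
      have et := (h01 t).resolve_right ht1
      rcases lt_trichotomy s t with h | rfl | h
      · have := hconst s hs t ht h
        rw [es, et] at this; norm_num at this
      · exact hs0 et
      · have := hconst t ht s hs h
        rw [es, et] at this; norm_num at this
    rw [← hI E hE, ← hI' E hE, ← nonpos_iff_eq_zero, min_le_iff]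
    refine hcase.imp (fun h => ?_) (fun h => ?_)
    · rw [nonpos_iff_eq_zero, ← lintegral_zero (μ := volume.restrict (Ioo (-l) l))]
      refine lintegral_congr_ae ?_
      filter_upwards [hRae] with t ht
      simp [h t ht]
    · rw [nonpos_iff_eq_zero, ← lintegral_zero (μ := volume.restrict (Ioo (-l) l))]
      refine lintegral_congr_ae ?_
      filter_upwards [hRae] with t ht
      simp [h t ht]
  · obtain ⟨α, δ, hα0, hα1, hδ0, hδ, hcube⟩ := exists_rpow_le_mixedLines n hn
    obtain ⟨C, hC, hmain⟩ := exists_min_setLIntegral_le hα0 hα1 hδ0 hδ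
      (show (1 : ℝ) ≤ n by exact_mod_cast hn)
    refine ⟨C, hC, fun l hl E hE ν hν hν1 => ?_⟩
    have : IsFiniteMeasure ν := ⟨hν1.trans (by simp)⟩
    obtain ⟨R, hRm, hR0, hosc⟩ := exists_measurableSet_abs_sub_le hE hν
    have hmfin : ∀ t, ∑ i, π (mixedLines unitMeasure (slice E t) i) ≠ ∞ := fun t =>
      ENNReal.sum_ne_top.2 fun i _ => measure_ne_top _ _
    have hmeas : ∀ i, Measurable fun t => π (mixedLines unitMeasure (slice E t) i) :=
      fun i => measurable_measure_mixedLines_slice hE i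
    have h := hmain l hl (fun t => (π (slice E t)).toReal)
      (fun t => (∑ i, π (mixedLines unitMeasure (slice E t) i)).toReal) (ν.map fun x => x 0) R hRm hR0
      (measurable_measure_slice hE).ennreal_toReal
      (Finset.measurable_sum _ fun i _ => hmeas i).ennreal_toReal
      (fun t => ENNReal.toReal_nonneg)
      (fun t => by
        rw [← ENNReal.toReal_one]
        exact ENNReal.toReal_mono (by simp) prob_le_one)
      (fun t => by
        rw [hcompl E hE, ← ENNReal.toReal_mul]
        exact ENNReal.toReal_mono (hmfin t)
          (measure_mul_measure_compl_le unitMeasure (measurableSet_slice hE t)))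
      (fun t ht => hcube unitMeasure _ (measurableSet_slice hE t) ht)
      (fun t ht => by
        rw [hcompl E hE] at ht ⊢
        have := hcube unitMeasure _ (measurableSet_slice hE t).compl ht
        simpa only [mixedLines_compl] using this)
      (fun T hT hTl => by
        simp_rw [ENNReal.ofReal_toReal (hmfin _)]
        rw [lintegral_finsetSum _ fun i _ => hmeas i]
        calc _ ≤ ∑ _i : Fin n, (ν.map fun x => x 0) T := Finset.sum_le_sum fun i _ =>
              setLIntegral_mixedLines_slice_le hE hν hT hTl i
          _ = _ := by simp)
      hosc (hmapreal ν hν1)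
    rwa [hI E hE, hI' E hE, hmap] at h

end Slices

end LongCuboid

namespace LongCuboid

open Metric

section Transfer

variable {n : ℕ}

/-- The parametrization of Euclidean space by rescaled coordinates centred at `x₀`. -/
noncomputable def rescale (x₀ : EuclideanSpace ℝ (Fin (n + 1))) (σ : ℝ) (v : Fin (n + 1) → ℝ) :
    EuclideanSpace ℝ (Fin (n + 1)) :=
  x₀ + σ • WithLp.toLp 2 v

/-- The inverse of `rescale x₀ σ`. -/
noncomputable def unscale (x₀ : EuclideanSpace ℝ (Fin (n + 1))) (σ : ℝ)
    (x : EuclideanSpace ℝ (Fin (n + 1))) : Fin (n + 1) → ℝ :=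
  WithLp.ofLp (σ⁻¹ • (x - x₀))

lemma unscale_rescale (x₀ : EuclideanSpace ℝ (Fin (n + 1))) {σ : ℝ} (hσ : 0 < σ)
    (v : Fin (n + 1) → ℝ) : unscale x₀ σ (rescale x₀ σ v) = v := by
  simp [unscale, rescale, smul_smul, inv_mul_cancel₀ hσ.ne']

lemma measurable_rescale (x₀ : EuclideanSpace ℝ (Fin (n + 1))) (σ : ℝ) :
    Measurable (rescale x₀ σ) :=
  ((WithLp.measurable_toLp 2 _).const_smul σ).const_add x₀

lemma measurable_unscale (x₀ : EuclideanSpace ℝ (Fin (n + 1))) (σ : ℝ) :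
    Measurable (unscale x₀ σ) :=
  (WithLp.measurable_ofLp 2 _).comp ((measurable_id.sub_const x₀).const_smul σ⁻¹)

lemma volume_preimage_rescale (x₀ : EuclideanSpace ℝ (Fin (n + 1))) {σ : ℝ} (hσ : 0 < σ)
    (A : Set (EuclideanSpace ℝ (Fin (n + 1)))) :
    volume (rescale x₀ σ ⁻¹' A) = ENNReal.ofReal ((σ ^ (n + 1))⁻¹) * volume A := by
  have h1 : rescale x₀ σ ⁻¹' A = (MeasurableEquiv.toLp 2 (Fin (n + 1) → ℝ)) ⁻¹'
      ((fun x => σ • x) ⁻¹' ((fun x => x₀ + x) ⁻¹' A)) := rfl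
  rw [h1, MeasurePreserving.measure_preimage_equiv
      (f := MeasurableEquiv.toLp 2 (Fin (n + 1) → ℝ)) (PiLp.volume_preserving_toLp (Fin (n + 1))),
    Measure.addHaar_preimage_smul _ hσ.ne', measure_preimage_add, finrank_euclideanSpace_fin,
    abs_of_pos (by positivity)]

lemma rescale_mem_cuboid_iff (x₀ : EuclideanSpace ℝ (Fin (n + 1))) {l σ : ℝ} (hσ : 0 < σ)
    (v : Fin (n + 1) → ℝ) :
    rescale x₀ σ v ∈ cuboid x₀ l σ ↔ v ∈ box n (Ioo (-(l / σ)) (l / σ)) := by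
  simp only [cuboid, box, mem_ofPred_eq]
  refine forall_congr' fun p => ?_
  have e : (rescale x₀ σ v) p - x₀ p = σ * v p := by simp [rescale]
  rw [e]
  have hp : ((p : ℕ) = 0) ↔ p = 0 := by rw [Fin.ext_iff]; rfl
  by_cases h : p = 0
  · rw [if_pos (hp.2 h), if_pos h, mem_Ioo, mem_Ioo, ← neg_div, div_lt_iff₀ hσ, lt_div_iff₀ hσ,
      mul_comm]
  · rw [if_neg (mt hp.1 h), if_neg h, mem_Ioo, mem_Ioo]
    constructor <;> rintro ⟨h1, h2⟩ <;> constructor <;> nlinarith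

lemma exists_lipschitzWith_rescale_lineMap (x₀ : EuclideanSpace ℝ (Fin (n + 1))) (σ : ℝ)
    (j : Fin (n + 1)) :
    ∃ K : ℝ, 0 < K ∧ ∀ q q', dist (rescale x₀ σ (lineMap j q)) (rescale x₀ σ (lineMap j q')) ≤
      K * dist q q' := by
  have h1 := PiLp.lipschitzWith_toLp 2 (fun _ : Fin (n + 1) => ℝ)
  set K₀ : NNReal := (Fintype.card (Fin (n + 1)) : NNReal) ^ (1 / (2 : ℝ≥0∞)).toReal with hK₀
  refine ⟨|σ| * K₀ + 1, by positivity, fun q q' => ?_⟩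
  have h2 : dist (lineMap j q) (lineMap j q') ≤ dist q q' := by
    refine (dist_pi_le_iff dist_nonneg).2 ((Fin.forall_iff_succAbove j).2 ⟨?_, fun k => ?_⟩)
    · rw [lineMap_apply_same, lineMap_apply_same]
      exact le_max_left _ _
    · rw [lineMap_apply_succAbove, lineMap_apply_succAbove]
      exact (dist_le_pi_dist _ _ k).trans (le_max_right _ _)
  have h3 := h1.dist_le_mul (lineMap j q) (lineMap j q')
  rw [rescale, rescale, dist_add_left, dist_smul₀, Real.norm_eq_abs]
  calc |σ| * dist (WithLp.toLp 2 (lineMap j q)) (WithLp.toLp 2 (lineMap j q'))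
      ≤ |σ| * (K₀ * dist (lineMap j q) (lineMap j q')) := by gcongr
    _ ≤ |σ| * (K₀ * dist q q') := by gcongr
    _ ≤ (|σ| * K₀ + 1) * dist q q' := by
        have : 0 ≤ dist q q' := dist_nonneg
        nlinarith

lemma mem_sparsePoints_of_tendsto (x₀ : EuclideanSpace ℝ (Fin (n + 1))) {σ : ℝ} (hσ : 0 < σ)
    {A : Set (EuclideanSpace ℝ (Fin (n + 1)))} (hA : MeasurableSet A) (j : Fin (n + 1))
    (q : ℝ × (Fin n → ℝ)) (h : rescale x₀ σ (lineMap j q) ∈ densityPoints A 0) :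
    q ∈ sparsePoints (lineMap j ⁻¹' (rescale x₀ σ ⁻¹' A)) := by
  obtain ⟨K, hK, hlip⟩ := exists_lipschitzWith_rescale_lineMap x₀ σ j
  set x := rescale x₀ σ (lineMap j q) with hx
  set c : ℝ≥0∞ := ENNReal.ofReal ((σ ^ (n + 1))⁻¹) * (ENNReal.ofReal (K ^ (n + 1)) *
    volume (ball (0 : EuclideanSpace ℝ (Fin (n + 1))) 1)) with hc
  have hcfin : c ≠ ∞ := ENNReal.mul_ne_top (by simp)
    (ENNReal.mul_ne_top (by simp) measure_ball_lt_top.ne)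
  have hscale : Tendsto (fun r : ℝ => K * r) (𝓝[>] 0) (𝓝[>] 0) := by
    refine tendsto_nhdsWithin_iff.2 ⟨?_, ?_⟩
    · have : Tendsto (fun r : ℝ => K * r) (𝓝 0) (𝓝 (K * 0)) := tendsto_id.const_mul K
      rw [mul_zero] at this
      exact this.mono_left nhdsWithin_le_nhds
    · filter_upwards [self_mem_nhdsWithin] with r hr using mul_pos hK hr
  have hlim := ENNReal.Tendsto.const_mul (a := c) (Tendsto.comp h hscale) (Or.inr hcfin)
  rw [mul_zero] at hlim
  refine tendsto_of_tendsto_of_tendsto_of_le_of_le' tendsto_const_nhds hlim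
    (Eventually.of_forall fun _ => zero_le) ?_
  filter_upwards [self_mem_nhdsWithin] with r hr
  have hr : 0 < r := hr
  have hsub : lineMap j ⁻¹' (rescale x₀ σ ⁻¹' A) ∩ ball q r ⊆
      lineMap j ⁻¹' (rescale x₀ σ ⁻¹' (A ∩ ball x (K * r))) := by
    rintro q' ⟨hq', hb⟩
    refine ⟨hq', ?_⟩
    rw [mem_ball] at hb ⊢
    exact (hlip q' q).trans_lt (by gcongr)
  have hvol : volume (lineMap j ⁻¹' (rescale x₀ σ ⁻¹' A) ∩ ball q r) ≤
      ENNReal.ofReal ((σ ^ (n + 1))⁻¹) * volume (A ∩ ball x (K * r)) := by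
    refine (measure_mono hsub).trans (le_of_eq ?_)
    rw [(volume_preserving_lineMap j).measure_preimage
      (measurable_rescale x₀ σ (hA.inter measurableSet_ball)).nullMeasurableSet,
      volume_preimage_rescale x₀ hσ]
  have hball : volume (ball x (K * r)) = ENNReal.ofReal (r ^ (n + 1)) *
      (ENNReal.ofReal (K ^ (n + 1)) * volume (ball (0 : EuclideanSpace ℝ (Fin (n + 1))) 1)) := by
    rw [Measure.addHaar_ball _ _ (by positivity), finrank_euclideanSpace_fin, mul_pow,
      mul_comm (K ^ _), ENNReal.ofReal_mul (by positivity), mul_assoc]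
  set B : ℝ≥0∞ := ENNReal.ofReal (K ^ (n + 1)) *
    volume (ball (0 : EuclideanSpace ℝ (Fin (n + 1))) 1) with hB
  have hB0 : B ≠ 0 := by
    have : 0 < K ^ (n + 1) := by positivity
    exact mul_ne_zero (by simpa using this) (measure_ball_pos _ _ one_pos).ne'
  have hBfin : B ≠ ∞ := ENNReal.mul_ne_top (by simp) measure_ball_lt_top.ne
  calc volume (lineMap j ⁻¹' (rescale x₀ σ ⁻¹' A) ∩ ball q r) / ENNReal.ofReal (r ^ (n + 1))
      ≤ ENNReal.ofReal ((σ ^ (n + 1))⁻¹) * volume (A ∩ ball x (K * r)) /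
          ENNReal.ofReal (r ^ (n + 1)) := by gcongr
    _ = c * (volume (A ∩ ball x (K * r)) / volume (ball x (K * r))) := by
        rw [hball, hc, mul_assoc, mul_div_assoc]
        congr 1
        rw [← mul_div_assoc, mul_comm (ENNReal.ofReal (r ^ (n + 1))) B,
          ENNReal.mul_div_mul_left _ _ hB0 hBfin]

lemma densityPoints_one_subset {A : Set (EuclideanSpace ℝ (Fin (n + 1)))} (hA : MeasurableSet A) :
    densityPoints A 1 ⊆ densityPoints Aᶜ 0 := by
  intro x hx
  have h := ENNReal.Tendsto.sub (tendsto_const_nhds (x := (1 : ℝ≥0∞)) (f := 𝓝[>] (0 : ℝ))) hx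
    (Or.inl (by simp))
  rw [tsub_self] at h
  refine h.congr' ?_
  filter_upwards [self_mem_nhdsWithin] with r hr
  have h0 : volume (ball x r) ≠ 0 := (measure_ball_pos _ _ hr).ne'
  have hfin : volume (ball x r) ≠ ∞ := measure_ball_lt_top.ne
  have hsum : volume (A ∩ ball x r) + volume (Aᶜ ∩ ball x r) = volume (ball x r) := by
    rw [inter_comm, inter_comm Aᶜ, ← sdiff_eq]
    exact measure_inter_add_sdiff _ hA
  have h1 : volume (A ∩ ball x r) / volume (ball x r) +
      volume (Aᶜ ∩ ball x r) / volume (ball x r) = 1 := by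
    rw [← ENNReal.add_div, hsum, ENNReal.div_self h0 hfin]
  have h2 : volume (A ∩ ball x r) / volume (ball x r) ≠ ∞ :=
    ne_top_of_le_ne_top ENNReal.one_ne_top (h1 ▸ le_self_add)
  rw [← h1, ENNReal.add_sub_cancel_left h2]

lemma rescale_mem_essentialBoundary (x₀ : EuclideanSpace ℝ (Fin (n + 1))) {σ : ℝ} (hσ : 0 < σ)
    {A : Set (EuclideanSpace ℝ (Fin (n + 1)))} (hA : MeasurableSet A) (j : Fin (n + 1))
    {q : ℝ × (Fin n → ℝ)}
    (hq : q ∉ sparsePoints (lineMap j ⁻¹' (rescale x₀ σ ⁻¹' A)) ∪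
      sparsePoints (lineMap j ⁻¹' (rescale x₀ σ ⁻¹' A))ᶜ) :
    rescale x₀ σ (lineMap j q) ∈ essentialBoundary A := by
  rintro (h | h)
  · exact hq (Or.inl (mem_sparsePoints_of_tendsto x₀ hσ hA j q h))
  · exact hq (Or.inr (mem_sparsePoints_of_tendsto x₀ hσ hA.compl j q (densityPoints_one_subset hA h)))

/-- Projecting along a coordinate direction does not increase the Hausdorff measure. -/
lemma volume_image_removeNth_unscale_le (x₀ : EuclideanSpace ℝ (Fin (n + 1))) {σ : ℝ} (hσ : 0 < σ)
    (j : Fin (n + 1)) (A : Set (EuclideanSpace ℝ (Fin (n + 1)))) :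
    volume ((fun x => j.removeNth (unscale x₀ σ x)) '' A) ≤
      ENNReal.ofReal ((σ ^ n)⁻¹) * Measure.euclideanHausdorffMeasure n A := by
  set p : EuclideanSpace ℝ (Fin (n + 1)) → EuclideanSpace ℝ (Fin n) :=
    fun x => WithLp.toLp 2 (j.removeNth (unscale x₀ σ x)) with hp
  have hlip : LipschitzWith (Real.toNNReal σ⁻¹) p := by
    refine LipschitzWith.of_dist_le_mul fun x y => ?_
    rw [Real.coe_toNNReal _ (by positivity)]
    have hsum : ∑ k, dist (p x k) (p y k) ^ 2 ≤ (σ⁻¹ * dist x y) ^ 2 := by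
      rw [mul_pow, EuclideanSpace.dist_eq, Real.sq_sqrt (by positivity), Fin.sum_univ_succAbove _ j,
        mul_add, Finset.mul_sum]
      refine le_trans (le_of_eq ?_) (le_add_of_nonneg_left (by positivity))
      refine Finset.sum_congr rfl fun k _ => ?_
      have : ∀ z : EuclideanSpace ℝ (Fin (n + 1)), p z k =
          σ⁻¹ * (z (j.succAbove k) - x₀ (j.succAbove k)) := fun z => by
        simp [hp, unscale, Fin.removeNth]
      rw [this, this, Real.dist_eq, Real.dist_eq, sq_abs, sq_abs]
      ring
    rw [EuclideanSpace.dist_eq (p x)]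
    exact Real.sqrt_le_iff.2 ⟨by positivity, hsum⟩
  have h1 : volume ((fun x => j.removeNth (unscale x₀ σ x)) '' A) = volume (p '' A) := by
    rw [← MeasurePreserving.measure_preimage_equiv
      (f := MeasurableEquiv.toLp 2 (Fin n → ℝ)) (PiLp.volume_preserving_toLp (Fin n)) (p '' A)]
    congr 1
    ext z
    constructor
    · rintro ⟨x, hx, rfl⟩
      exact ⟨x, hx, rfl⟩
    · rintro ⟨x, hx, h⟩
      exact ⟨x, hx, (MeasurableEquiv.toLp 2 (Fin n → ℝ)).injective h⟩
  rw [h1, ← EuclideanSpace.euclideanHausdorffMeasure_eq_volume,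
    Measure.euclideanHausdorffMeasure_def, Measure.euclideanHausdorffMeasure_def,
    Measure.smul_apply, Measure.smul_apply, ENNReal.smul_def, ENNReal.smul_def, smul_eq_mul,
    smul_eq_mul, mul_left_comm]
  gcongr
  refine (hlip.hausdorffMeasure_image_le (Nat.cast_nonneg n) A).trans (le_of_eq ?_)
  congr 1
  rw [ENNReal.rpow_natCast, ← inv_pow, ENNReal.ofReal_pow (by positivity)]
  rfl

lemma controlsMixedSegments (x₀ : EuclideanSpace ℝ (Fin (n + 1))) {l σ : ℝ} (hσ : 0 < σ)
    {A : Set (EuclideanSpace ℝ (Fin (n + 1)))} (hA : MeasurableSet A) :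
    ControlsMixedSegments (ENNReal.ofReal ((σ ^ n)⁻¹) • ((Measure.euclideanHausdorffMeasure n).restrict
      (essentialBoundary A ∩ cuboid x₀ l σ)).map (unscale x₀ σ)) (rescale x₀ σ ⁻¹' A) (l / σ) := by
  intro j a b Z hZ hbox
  set W : Set (Fin (n + 1) → ℝ) := {x | x j ∈ Ioo a b ∧ j.removeNth x ∈ Z} with hW
  have hWm : MeasurableSet W :=
    (measurable_pi_apply j measurableSet_Ioo).inter (measurable_removeNth j hZ)
  rw [Measure.smul_apply, Measure.map_apply (measurable_unscale x₀ σ) hWm,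
    Measure.restrict_apply (measurable_unscale x₀ σ hWm), smul_eq_mul]
  refine le_trans (measure_mono_ae ?_) (volume_image_removeNth_unscale_le x₀ hσ j _)
  have hEm : MeasurableSet (lineMap j ⁻¹' (rescale x₀ σ ⁻¹' A)) :=
    measurable_lineMap j (measurable_rescale x₀ σ hA)
  filter_upwards [ae_slice_null_or_full hEm] with z hz hzm
  obtain ⟨hzZ, hz1, hz2⟩ := hzm
  have hex : ∃ s ∈ Ioo a b, (s, z) ∉ sparsePoints (lineMap j ⁻¹' (rescale x₀ σ ⁻¹' A)) ∪
      sparsePoints (lineMap j ⁻¹' (rescale x₀ σ ⁻¹' A))ᶜ := by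
    by_contra! hcon
    rcases hz a b hcon with h | h
    · exact hz1 h
    · exact hz2 h
  obtain ⟨s, hs, hsz⟩ := hex
  refine ⟨rescale x₀ σ (lineMap j (s, z)), ⟨?_, rescale_mem_essentialBoundary x₀ hσ hA j hsz,
    (rescale_mem_cuboid_iff x₀ hσ _).2 (hbox s hs z hzZ)⟩, ?_⟩
  · rw [mem_preimage, unscale_rescale x₀ hσ]
    exact ⟨by rwa [lineMap_apply_same], by rwa [removeNth_lineMap]⟩
  · simp only
    rw [unscale_rescale x₀ hσ, removeNth_lineMap]

end Transfer

lemma essentialBoundary_congr {d : ℕ} {A B : Set (EuclideanSpace ℝ (Fin d))}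
    (h : A =ᵐ[volume] B) : essentialBoundary A = essentialBoundary B := by
  have : ∀ x r, volume (A ∩ Metric.ball x r) = volume (B ∩ Metric.ball x r) := fun x r =>
    measure_congr (h.inter (ae_eq_refl _))
  simp only [essentialBoundary, densityPoints, this]

/-- The relative isoperimetric inequality in long cuboids, for measurable sets. -/
theorem exists_min_volume_cuboid_le (n : ℕ) : ∃ C : ℝ, 1 ≤ C ∧ ∀ l σ : ℝ, 0 < σ → 1 ≤ l / σ →
    ∀ (x₀ : EuclideanSpace ℝ (Fin (n + 1))) (A : Set (EuclideanSpace ℝ (Fin (n + 1)))),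
    MeasurableSet A → relativePerimeter A (cuboid x₀ l σ) < ENNReal.ofReal (σ ^ n) →
    min (volume (A ∩ cuboid x₀ l σ)) (volume (cuboid x₀ l σ \ A)) ≤
      ENNReal.ofReal (C * σ) * relativePerimeter A (cuboid x₀ l σ) := by
  obtain ⟨C, hC, hmain⟩ := exists_min_volume_box_le n
  refine ⟨C, hC, fun l σ hσ hlσ x₀ A hA hlt => ?_⟩
  have hrel : relativePerimeter A (cuboid x₀ l σ) =
      Measure.euclideanHausdorffMeasure n (essentialBoundary A ∩ cuboid x₀ l σ) := rfl
  have hσn : 0 < σ ^ n := by positivity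
  have h := hmain (l / σ) hlσ _ (measurable_rescale x₀ σ hA) _ (controlsMixedSegments (l := l) x₀ hσ hA)
  rw [Measure.smul_apply, Measure.map_apply (measurable_unscale x₀ σ) MeasurableSet.univ, preimage_univ,
    Measure.restrict_apply_univ, ← hrel, smul_eq_mul] at h
  have hcub : rescale x₀ σ ⁻¹' cuboid x₀ l σ = box n (Ioo (-(l / σ)) (l / σ)) := by
    ext v; exact rescale_mem_cuboid_iff x₀ hσ v
  rw [← hcub, ← preimage_inter, ← preimage_sdiff, volume_preimage_rescale x₀ hσ,
    volume_preimage_rescale x₀ hσ] at h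
  have hlt1 : ENNReal.ofReal ((σ ^ n)⁻¹) * relativePerimeter A (cuboid x₀ l σ) < 1 := by
    calc _ < ENNReal.ofReal ((σ ^ n)⁻¹) * ENNReal.ofReal (σ ^ n) :=
          ENNReal.mul_lt_mul_right (by simpa using hσn) (by simp) hlt
      _ = 1 := by rw [← ENNReal.ofReal_mul (by positivity), inv_mul_cancel₀ hσn.ne', ENNReal.ofReal_one]
  have h' := h hlt1
  have hmul : ∀ V : ℝ≥0∞, ENNReal.ofReal (σ ^ (n + 1)) * (ENNReal.ofReal ((σ ^ (n + 1))⁻¹) * V) = V := by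
    intro V
    rw [← mul_assoc, ← ENNReal.ofReal_mul (by positivity), mul_inv_cancel₀ (by positivity),
      ENNReal.ofReal_one, one_mul]
  have key : ∀ V : ℝ≥0∞, ENNReal.ofReal ((σ ^ (n + 1))⁻¹) * V ≤ ENNReal.ofReal C *
      (ENNReal.ofReal ((σ ^ n)⁻¹) * relativePerimeter A (cuboid x₀ l σ)) →
      V ≤ ENNReal.ofReal (C * σ) * relativePerimeter A (cuboid x₀ l σ) := by
    intro V hV
    rw [← hmul V]
    calc _ ≤ ENNReal.ofReal (σ ^ (n + 1)) * (ENNReal.ofReal C *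
          (ENNReal.ofReal ((σ ^ n)⁻¹) * relativePerimeter A (cuboid x₀ l σ))) := by gcongr
      _ = _ := by
        rw [← mul_assoc, ← mul_assoc, ← ENNReal.ofReal_mul (by positivity),
          ← ENNReal.ofReal_mul (by positivity)]
        congr 2
        rw [pow_succ]
        field_simp
  rcases min_le_iff.1 h' with h | h
  · exact (min_le_left _ _).trans (key _ h)
  · exact (min_le_right _ _).trans (key _ h)

end LongCuboid

theorem proposition3p8 (d : ℕ) (hd : 1 ≤ d) :
    ∃ C : ℝ, 1 ≤ C ∧
      ∀ (l σ : ℝ), 0 < l → 0 < σ → 1 ≤ l / σ →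
      ∀ (x₀ : EuclideanSpace ℝ (Fin d)) (P : Set (EuclideanSpace ℝ (Fin d))),
        P ⊆ LongCuboid.cuboid x₀ l σ →
        LongCuboid.HasFinitePerimeterIn P (LongCuboid.cuboid x₀ l σ) →
        LongCuboid.relativePerimeter P (LongCuboid.cuboid x₀ l σ) < ENNReal.ofReal (σ ^ (d - 1)) →
        min (volume P) (volume (LongCuboid.cuboid x₀ l σ \ P)) ≤
          ENNReal.ofReal (C * σ) *
            LongCuboid.relativePerimeter P (LongCuboid.cuboid x₀ l σ) := by
  obtain ⟨n, rfl⟩ : ∃ n, d = n + 1 := ⟨d - 1, by omega⟩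
  obtain ⟨C, hC, hmain⟩ := LongCuboid.exists_min_volume_cuboid_le n
  refine ⟨C, hC, fun l σ _ hσ hlσ x₀ P hP hper hlt => ?_⟩
  obtain ⟨A, -, hAm, hAP⟩ := hper.nullMeasurableSet.exists_measurable_superset_ae_eq
  have hrel : LongCuboid.relativePerimeter A (LongCuboid.cuboid x₀ l σ) =
      LongCuboid.relativePerimeter P (LongCuboid.cuboid x₀ l σ) := by
    rw [LongCuboid.relativePerimeter, LongCuboid.relativePerimeter,
      LongCuboid.essentialBoundary_congr hAP]
  have h := hmain l σ hσ hlσ x₀ A hAm (by rw [hrel]; exact hlt)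
  have e1 : volume (A ∩ LongCuboid.cuboid x₀ l σ) = volume P := by
    rw [measure_congr (hAP.inter (ae_eq_refl (LongCuboid.cuboid x₀ l σ))), inter_eq_left.2 hP]
  have e2 : volume (LongCuboid.cuboid x₀ l σ \ A) = volume (LongCuboid.cuboid x₀ l σ \ P) :=
    measure_congr ((ae_eq_refl (LongCuboid.cuboid x₀ l σ)).diff hAP)
  rwa [e1, e2, hrel] at h
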